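/- **Setting.** Let $1\le p\le n$, $p+1\le m\le 2n$, and let $f:\mathbb R^n\to\mathbb R$ be differentiable with $L_g$-Lipschitz gradient and bounded below by $f_{\min}$. StoDARS (unconstrained case) has parameters $\delta_0>0$, $\varepsilon_f>0$, $\gamma>2$, $0<\tau<\sqrt{(\gamma-2)/(\gamma+2)}$, $\delta_{\max}=\tau^{-j_{\max}}\delta_0$ ($j_{\max}\in\mathbb N$) and a deterministic starting point $x_0$. At iteration $k$ one draws the first $p$ columns $U_k\in\mathbb R^{n\times p}$ of a Haar-distributed orthogonal $n\times n$ matrix and a random matrix $D_k\in\mathbb R^{p\times m}$ whose columns $d_{k,1},\dots,d_{k,m}$ are unit vectors that positively span $\mathbb R^p$, where $U_k$ and $D_k$ are independent of each other and jointly independent of the past $\mathcal F_{k-1}$; one obtains random estimates $f_k(0)$ of $f(x_k)$ and $f_k(u)$ of $f(x_k+\delta_k u)$ for every poll direction $u\in\mathbb U_k:=\{U_kd_{k,j}\}_{j\le m}$. A trial direction $u_k\in\mathbb U_k$ is selected as a measurable function of the history through iteration $k$. If some $u\in\mathbb U_k$ satisfies $f_k(u)-f_k(0)\le-\gamma\varepsilon_f\delta_k^2$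 (success), then $u_k$ is such a $u$ and $x_{k+1}=x_k+\delta_ku_k$, $\delta_{k+1}=\min\{\tau^{-1}\delta_k,\delta_{\max}\}$; otherwise $x_{k+1}=x_k$, $\delta_{k+1}=\tau\delta_k$. Put $Q_k=\sqrt{n/p}\,U_k$. Let $\mathcal F_{k-1}$ be the $\sigma$-algebra generated by the estimates, $Q_\ell$ and $D_\ell$ with $\ell<k$, and let $\mathcal F^{Q\cdot D}_{k-1}$ be generated by $\mathcal F_{k-1}$, $Q_k$ and $D_k$. **Assumptions.** (1) For fixed $\alpha_Q,\beta_Q\in(0,1/2)$ and all $k$, $v\in\mathbb R^n$: $\mathbb P(\|Q_k^{\top}v\|\ge\alpha_Q\|v\|)\ge1-\beta_Q$. (2) For some $\kappa_{\min}>0$, almost surely for all $k$, the cosine measure $\min_{w\ne0}\max_j\frac{\langle w,d_{k,j}\rangle}{\|w\|\,\|d_{k,j}\|}$ is at least $\kappa_{\min}$. (3) $\nu\in(0,1)$ satisfies $\frac{\nu}{1-\nu}\ge\frac{2(\tau^{-2}-1)}{\gamma-2}$, and $\beta_f\in(0,1)$ satisfies $\frac{\beta_f}{1-\beta_f}\ge\frac{4\nu}{(1-\nu)(1-\tau^2)}$.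 (4) With $J_k$ the event that $|f_k(0)-f(x_k)|\le\varepsilon_f\delta_k^2$ and $|f_k(u)-f(x_k+\delta_ku)|\le\varepsilon_f\delta_k^2$ for all $u\in\mathbb U_k$, one has $\mathbb P(J_k\mid\mathcal F^{Q\cdot D}_{k-1})\ge\beta_f$ almost surely for all $k$. (5) The errors $f_k(0)-f(x_k)$ and $f_k(u_k)-f(x_k+\delta_ku_k)$ are square integrable and, almost surely for all $k$, the conditional expectations of their squares given $\mathcal F^{Q\cdot D}_{k-1}$ are at most $\varepsilon_f^2(1-\beta_f)\delta_k^4$. (6) $\tilde\beta:=\beta_f(1-\beta_Q)>1/2$. **Theorem.** Put $\phi_0=\frac{\nu}{\varepsilon_f}(f(x_0)-f_{\min})+(1-\nu)\delta_0^2$, $\varrho=\frac12\beta_f(1-\nu)(1-\tau^2)$, $\hat\xi=\kappa_{\min}^{-1}\alpha_Q^{-1}\bigl(L_g\sqrt{n/p}+(\gamma+2)\varepsilon_f\bigr)$ and, for $\epsilon\in(0,1)$, $T_\epsilon=\inf\{k\in\mathbb N:\|\nabla f(x_k)\|\le\epsilon\}$ (with $\inf\emptyset=\infty$). There is a constant $\tilde\xi\ge\hat\xi$,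 depending only on $n,p,\alpha_Q,\beta_Q,\kappa_{\min},L_g$ and the algorithm's parameters $\delta_0,\varepsilon_f,\gamma,\tau,j_{\max}$ (in particular not on $\epsilon$), such that for all $\epsilon\in(0,1)$ $$\mathbb E[T_\epsilon]\le\frac{\tilde\beta}{2\tilde\beta-1}\cdot\frac{\phi_0\,\tilde\xi^2}{\varrho\,\epsilon^2}+1 .$$ In particular there is a constant $C$, independent of $\epsilon$, with $\mathbb E[T_\epsilon]\le C\epsilon^{-2}$ for all $\epsilon\in(0,1)$. -/

import Mathlib

open MeasureTheory ProbabilityTheory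
open scoped NNReal ENNReal Gradient

namespace StoDARS

noncomputable section

/-- Euclidean space of dimension `n`. -/
abbrev Vec (n : ℕ) : Type := EuclideanSpace ℝ (Fin n)

/-- Matrices carry the product `σ`-algebra of their entries. -/
instance instMeasurableSpaceMatrix (n p : ℕ) : MeasurableSpace (Matrix (Fin n) (Fin p) ℝ) :=
  inferInstanceAs (MeasurableSpace (Fin n → Fin p → ℝ))

/-- The cosine measure of a set of directions `S`: the minimum over nonzero `w` of the largest
cosine of the angle between `w` and an element of `S`. -/
def cosineMeasure {q : ℕ} (S : Set (Vec q)) : ℝ :=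
  ⨅ w : {w : Vec q // w ≠ 0}, ⨆ d : S,
    inner ℝ (w : Vec q) (d : Vec q) / (‖(w : Vec q)‖ * ‖(d : Vec q)‖)

/-- `S` is a positive spanning set: every vector is a nonnegative linear combination of
elements of `S`. -/
def IsPositiveSpanning {q : ℕ} (S : Set (Vec q)) : Prop :=
  Submodule.span ℝ≥0 S = ⊤

/-- A random matrix `Q` is `(1 - β)`-probabilistically `α`-well aligned. -/
def IsWellAligned {Ω : Type*} [MeasurableSpace Ω] (μ : Measure Ω) {n p : ℕ}
    (Q : Ω → Matrix (Fin n) (Fin p) ℝ) (α β : ℝ) : Prop :=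
  ∀ v : Vec n, 1 - β ≤ μ.real {ω | α * ‖v‖ ≤ ‖Matrix.toEuclideanLin (Q ω).transpose v‖}

/-- A random orthogonal matrix is Haar distributed: its law is invariant under left and right
translations of the orthogonal group. -/
structure IsHaarDistributed {Ω : Type*} [MeasurableSpace Ω] (μ : Measure Ω) {n : ℕ}
    (U : Ω → Matrix.orthogonalGroup (Fin n) ℝ) : Prop where
  measurable : Measurable U
  left_invariant : ∀ O : Matrix.orthogonalGroup (Fin n) ℝ,
    μ.map (fun ω => O * U ω) = μ.map U
  right_invariant : ∀ O : Matrix.orthogonalGroup (Fin n) ℝ,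
    μ.map (fun ω => U ω * O) = μ.map U

/-- The deterministic parameters of the algorithm. -/
structure Params where
  /-- initial stepsize -/
  δ₀ : ℝ
  /-- accuracy constant of the estimates -/
  εf : ℝ
  /-- sufficient decrease constant -/
  γ : ℝ
  /-- stepsize update factor -/
  τ : ℝ
  /-- the largest stepsize is `τ ^ (-jmax) * δ₀` -/
  jmax : ℕ

/-- The requirements of the initialization step. -/
structure Params.Admissible (P : Params) : Prop where
  δ₀_pos : 0 < P.δ₀
  εf_pos : 0 < P.εf
  two_lt_γ : 2 < P.γ
  τ_pos : 0 < P.τ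
  τ_lt : P.τ < √((P.γ - 2) / (P.γ + 2))

/-- The upper bound on the stepsizes. -/
def Params.δmax (P : Params) : ℝ := (P.τ ^ P.jmax)⁻¹ * P.δ₀

/-- The random quantities which drive the algorithm in the unconstrained case: dimensions
`p ≤ n`, `m` poll directions per iteration. -/
structure Inputs (Ω : Type*) (n p m : ℕ) where
  p_le_n : p ≤ n
  /-- the random orthogonal matrix drawn at iteration `k` -/
  U : ℕ → Ω → Matrix.orthogonalGroup (Fin n) ℝ
  /-- the random `p × m` matrix drawn at iteration `k`, given by its columns -/
  D : ℕ → Ω → Fin m → Vec p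
  /-- the estimate of `f` at the incumbent of iteration `k` -/
  est₀ : ℕ → Ω → ℝ
  /-- the estimate of `f` at the `j`-th poll point of iteration `k` -/
  est : ℕ → Fin m → Ω → ℝ
  /-- the index of the trial direction `u` which the poll step of iteration `k` ends with: on a
  successful iteration the accepted one, on an unsuccessful one any of the poll directions -/
  pick : ℕ → Ω → Fin m

namespace Inputs

variable {Ω : Type*} {n p m : ℕ} (R : Inputs Ω n p m)

/-- The first `p` columns of the orthogonal matrix of iteration `k`. -/
def Usub (k : ℕ) (ω : Ω) : Matrix (Fin n) (Fin p) ℝ :=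
  (R.U k ω : Matrix (Fin n) (Fin n) ℝ).submatrix id (Fin.castLE R.p_le_n)

/-- The rescaled matrix `√(n/p) U`. -/
def Q (k : ℕ) (ω : Ω) : Matrix (Fin n) (Fin p) ℝ :=
  √((n : ℝ) / (p : ℝ)) • R.Usub k ω

/-- The `j`-th poll direction of iteration `k`, in the full space. -/
def pollDir (k : ℕ) (j : Fin m) (ω : Ω) : Vec n :=
  Matrix.toEuclideanLin (R.Usub k ω) (R.D k ω j)

/-- One iteration from incumbent `s.1` and stepsize `s.2`. It is successful if the estimates show
the decrease `γ εf δ ^ 2` at some poll point. -/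
def step (P : Params) (k : ℕ) (ω : Ω) (s : Vec n × ℝ) : Vec n × ℝ :=
  open Classical in
  if ∃ j, R.est k j ω - R.est₀ k ω ≤ -(P.γ * P.εf * s.2 ^ 2) then
    (s.1 + s.2 • R.pollDir k (R.pick k ω) ω, min (P.τ⁻¹ * s.2) P.δmax)
  else
    (s.1, P.τ * s.2)

/-- Incumbent and stepsize at the start of iteration `k`. -/
def state (P : Params) (x₀ : Vec n) : ℕ → Ω → Vec n × ℝ
  | 0, _ => (x₀, P.δ₀)
  | k + 1, ω => R.step P k ω (state P x₀ k ω)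

/-- The incumbent of iteration `k`. -/
def x (P : Params) (x₀ : Vec n) (k : ℕ) (ω : Ω) : Vec n := (R.state P x₀ k ω).1

/-- The stepsize of iteration `k`. -/
def δ (P : Params) (x₀ : Vec n) (k : ℕ) (ω : Ω) : ℝ := (R.state P x₀ k ω).2

/-- The `σ`-algebra `F_{k-1}` of the history before iteration `k`: generated by all estimates,
matrices `Q` and `D` of the iterations `0, …, k - 1` (trivial for `k = 0`, since `x₀` is
deterministic). -/
@[reducible] def past (k : ℕ) : MeasurableSpace Ω :=
  ⨆ ℓ : ℕ, ⨆ _ : ℓ < k,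
    MeasurableSpace.comap (R.est₀ ℓ) inferInstance ⊔
    (⨆ j : Fin m, MeasurableSpace.comap (R.est ℓ j) inferInstance) ⊔
    MeasurableSpace.comap (R.Q ℓ) inferInstance ⊔
    MeasurableSpace.comap (R.D ℓ) inferInstance

/-- The `σ`-algebra `F^{Q·D}_{k-1}`: the history together with `Q` and `D` of iteration `k`. -/
@[reducible] def pastQD (k : ℕ) : MeasurableSpace Ω :=
  R.past k ⊔ MeasurableSpace.comap (R.Q k) inferInstance ⊔
    MeasurableSpace.comap (R.D k) inferInstance

/-- The random inputs are those of a run of the algorithm. -/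
structure IsRun [MeasurableSpace Ω] (μ : Measure Ω) (P : Params) (x₀ : Vec n)
    (αQ βQ : ℝ) : Prop where
  measurable_est₀ : ∀ k, Measurable (R.est₀ k)
  measurable_est : ∀ k j, Measurable (R.est k j)
  measurable_D : ∀ k, Measurable (R.D k)
  /-- the selected direction is determined by what is known at the end of iteration `k` -/
  measurable_pick : ∀ k, Measurable[R.past (k + 1)] (R.pick k)
  /-- on a successful iteration the selected direction shows the required decrease -/
  pick_spec : ∀ k ω,
    (∃ j, R.est k j ω - R.est₀ k ω ≤ -(P.γ * P.εf * R.δ P x₀ k ω ^ 2)) →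
      R.est k (R.pick k ω) ω - R.est₀ k ω ≤ -(P.γ * P.εf * R.δ P x₀ k ω ^ 2)
  haar : ∀ k, IsHaarDistributed μ (R.U k)
  wellAligned : ∀ k, IsWellAligned μ (R.Q k) αQ βQ
  indep_U_D : ∀ k, IndepFun (R.Usub k) (R.D k) μ
  /-- the matrices of iteration `k` are drawn independently of the past -/
  indep_past : ∀ k, Indep
    (MeasurableSpace.comap (fun ω => (R.Q k ω, R.D k ω)) inferInstance) (R.past k) μ
  /-- the columns of `D` form a positive spanning set contained in the unit sphere -/
  norm_D : ∀ k, ∀ᵐ ω ∂μ, ∀ j, ‖R.D k ω j‖ = 1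
  spanning_D : ∀ k, ∀ᵐ ω ∂μ, IsPositiveSpanning (Set.range (R.D k ω))

/-- The event `J_k` that the estimates of iteration `k` at the incumbent and at the poll points
are `εf`-accurate. -/
def accurate (P : Params) (x₀ : Vec n) (f : Vec n → ℝ) (k : ℕ) : Set Ω :=
  {ω | |R.est₀ k ω - f (R.x P x₀ k ω)| ≤ P.εf * R.δ P x₀ k ω ^ 2 ∧
    ∀ j, |R.est k j ω - f (R.x P x₀ k ω + R.δ P x₀ k ω • R.pollDir k j ω)|
      ≤ P.εf * R.δ P x₀ k ω ^ 2}

/-- The error of the estimate at the incumbent. -/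
def err₀ (P : Params) (x₀ : Vec n) (f : Vec n → ℝ) (k : ℕ) (ω : Ω) : ℝ :=
  R.est₀ k ω - f (R.x P x₀ k ω)

/-- The error of the estimate at the trial point given by the selected random direction. -/
def err (P : Params) (x₀ : Vec n) (f : Vec n → ℝ) (k : ℕ) (ω : Ω) : ℝ :=
  R.est k (R.pick k ω) ω -
    f (R.x P x₀ k ω + R.δ P x₀ k ω • R.pollDir k (R.pick k ω) ω)

/-- The estimates are `βf`-probabilistically `εf`-accurate and satisfy the variance conditions
(the second moments are finite, so that the conditional expectations are the true ones). -/
structure EstimatesOK [MeasurableSpace Ω] (μ : Measure Ω) (P : Params) (x₀ : Vec n)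
    (f : Vec n → ℝ) (βf : ℝ) : Prop where
  accurate : ∀ k, ∀ᵐ ω ∂μ,
    βf ≤ (μ[(R.accurate P x₀ f k).indicator (fun _ => (1 : ℝ)) | R.pastQD k]) ω
  memLp_err₀ : ∀ k, MemLp (R.err₀ P x₀ f k) 2 μ
  memLp_err : ∀ k, MemLp (R.err P x₀ f k) 2 μ
  variance₀ : ∀ k, ∀ᵐ ω ∂μ,
    (μ[fun ω' => |R.err₀ P x₀ f k ω'| ^ 2 | R.pastQD k]) ω
      ≤ P.εf ^ 2 * (1 - βf) * R.δ P x₀ k ω ^ 4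
  variance : ∀ k, ∀ᵐ ω ∂μ,
    (μ[fun ω' => |R.err P x₀ f k ω'| ^ 2 | R.pastQD k]) ω
      ≤ P.εf ^ 2 * (1 - βf) * R.δ P x₀ k ω ^ 4

/-- The first iteration at which the gradient norm is at most `ε` (`⊤` if there is none). -/
def hitTime (P : Params) (x₀ : Vec n) (f : Vec n → ℝ) (ε : ℝ) (ω : Ω) : ℕ∞ :=
  ⨅ k : ℕ, ⨅ _ : ‖∇ f (R.x P x₀ k ω)‖ ≤ ε, (k : ℕ∞)

/-- The expected number of iterations needed to reach a gradient norm of at most `ε`. -/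
def expectedHitTime [MeasurableSpace Ω] (μ : Measure Ω) (P : Params) (x₀ : Vec n)
    (f : Vec n → ℝ) (ε : ℝ) : ℝ≥0∞ :=
  ∫⁻ ω, (R.hitTime P x₀ f ε ω : ℝ≥0∞) ∂μ

end Inputs

/-- The threshold constant `κmin⁻¹ αQ⁻¹ (L √(n/p) + (γ + 2) εf)`. -/
def xiHat (P : Params) (n p : ℕ) (αQ κmin : ℝ) (L : ℝ≥0) : ℝ :=
  κmin⁻¹ * αQ⁻¹ * ((L : ℝ) * √((n : ℝ) / (p : ℝ)) + (P.γ + 2) * P.εf)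

/-- The initial value `(ν / εf) (f x₀ - fmin) + (1 - ν) δ₀ ^ 2` of the merit function. -/
def phiZero (P : Params) {n : ℕ} (x₀ : Vec n) (f : Vec n → ℝ) (fmin ν : ℝ) : ℝ :=
  ν / P.εf * (f x₀ - fmin) + (1 - ν) * P.δ₀ ^ 2

/-- The constant `βf (1 - ν) (1 - τ ^ 2) / 2`. -/
def rho (P : Params) (ν βf : ℝ) : ℝ :=
  1 / 2 * βf * (1 - ν) * (1 - P.τ ^ 2)

end

end StoDARS

namespace StoDARS

variable {P : Params}

/-! Fix a threshold `d` proportional to `ε`. Before the hitting time, iterations with stepsize at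
least `τ d` ("large") and below it ("small") are counted separately, in expectation.

Large iterations are expensive. The merit function, a weighted sum of `f (x_k) - fmin` and `δ_k ^
2`, loses at least `rho * E[δ_k ^ 2]` in expectation at every iteration, whatever the gradient
(`IsRun.integral_merit_succ_le`). Since it is nonnegative, telescoping bounds the sum of `E[δ_k ^
2]` by `phiZero / rho`, and Markov's inequality bounds the expected number of large iterations by
`phiZero / (rho (τ d) ^ 2)`.

Small iterations tend to succeed. If the gradient exceeds `ε`, the subspace is aligned and the
estimates are accurate, then a small stepsize forces success (`mem_successful_of_accurate`). Given
the past, this happens with probability at least `b = βf (1 - βQ) > 1/2`. Hence `max 0 (log (d /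
δ_k))` has negative drift on small iterations and rises by at most `-log τ` on large ones. It starts
at zero and stays nonnegative, so `2 b - 1` times the expected number of small iterations is at most
the expected number of large ones (`IsRun.sum_measureReal_small_le`).

Together the expected hitting time is at most `2 b / (2 b - 1)` times the bound for large
iterations. All conditional statements are used integrated over events of the past, so neither
martingales nor optional stopping are needed. -/

lemma Params.Admissible.τ_lt_one (hP : P.Admissible) : P.τ < 1 := by
  have h2 := hP.two_lt_γ
  refine hP.τ_lt.trans_le ?_
  rw [Real.sqrt_le_one]
  rw [div_le_one (by linarith)]
  linarith

lemma Params.Admissible.δ₀_le_δmax (hP : P.Admissible) : P.δ₀ ≤ P.δmax := by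
  have h := one_le_inv₀ (pow_pos hP.τ_pos P.jmax) |>.2
    (pow_le_one₀ hP.τ_pos.le hP.τ_lt_one.le)
  exact le_mul_of_one_le_left hP.δ₀_pos.le h

lemma Params.Admissible.δmax_pos (hP : P.Admissible) : 0 < P.δmax :=
  hP.δ₀_pos.trans_le hP.δ₀_le_δmax

/-! ### Stepsize dynamics along a run -/

namespace Inputs

variable {Ω : Type*} {n p m : ℕ} {R : Inputs Ω n p m} {x₀ : Vec n}

/-- The event that iteration `k` is successful. -/
def successful (R : Inputs Ω n p m) (P : Params) (x₀ : Vec n) (k : ℕ) : Set Ω :=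
  {ω | ∃ j, R.est k j ω - R.est₀ k ω ≤ -(P.γ * P.εf * R.δ P x₀ k ω ^ 2)}

lemma x_succ_of_successful {k : ℕ} {ω : Ω} (h : ω ∈ R.successful P x₀ k) :
    R.x P x₀ (k + 1) ω =
      R.x P x₀ k ω + R.δ P x₀ k ω • R.pollDir k (R.pick k ω) ω := by
  have h' : ∃ j, R.est k j ω - R.est₀ k ω ≤ -(P.γ * P.εf * (R.state P x₀ k ω).2 ^ 2) := h
  simp only [x, δ, state, step, if_pos h']

lemma δ_succ_of_successful {k : ℕ} {ω : Ω} (h : ω ∈ R.successful P x₀ k) :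
    R.δ P x₀ (k + 1) ω = min (P.τ⁻¹ * R.δ P x₀ k ω) P.δmax := by
  have h' : ∃ j, R.est k j ω - R.est₀ k ω ≤ -(P.γ * P.εf * (R.state P x₀ k ω).2 ^ 2) := h
  simp only [δ, state, step, if_pos h']

lemma x_succ_of_not_successful {k : ℕ} {ω : Ω} (h : ω ∉ R.successful P x₀ k) :
    R.x P x₀ (k + 1) ω = R.x P x₀ k ω := by
  have h' : ¬ ∃ j, R.est k j ω - R.est₀ k ω ≤ -(P.γ * P.εf * (R.state P x₀ k ω).2 ^ 2) := h
  simp only [x, state, step, if_neg h']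

lemma δ_succ_of_not_successful {k : ℕ} {ω : Ω} (h : ω ∉ R.successful P x₀ k) :
    R.δ P x₀ (k + 1) ω = P.τ * R.δ P x₀ k ω := by
  have h' : ¬ ∃ j, R.est k j ω - R.est₀ k ω ≤ -(P.γ * P.εf * (R.state P x₀ k ω).2 ^ 2) := h
  simp only [δ, state, step, if_neg h']

lemma δ_le_δmax (hP : P.Admissible) (k : ℕ) (ω : Ω) : R.δ P x₀ k ω ≤ P.δmax := by
  induction k with
  | zero => exact hP.δ₀_le_δmax
  | succ k ih =>
    by_cases h : ω ∈ R.successful P x₀ k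
    · rw [δ_succ_of_successful h]; exact min_le_right _ _
    · rw [δ_succ_of_not_successful h]
      have := hP.δmax_pos
      nlinarith [hP.τ_pos, hP.τ_lt_one]

/-- A deterministic lower bound at each fixed `k`: it makes the weight `1 / δ_k ^ 2` and the
logarithm of `1 / δ_k` bounded above, hence the integrals below finite. -/
lemma pow_mul_le_δ (hP : P.Admissible) (k : ℕ) (ω : Ω) :
    P.τ ^ k * P.δ₀ ≤ R.δ P x₀ k ω := by
  have h0 := hP.δ₀_pos
  have hτ := hP.τ_pos
  induction k with
  | zero => simp [δ, state]
  | succ k ih =>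
    by_cases h : ω ∈ R.successful P x₀ k
    · rw [δ_succ_of_successful h]
      refine le_min ?_ ?_
      · have h1 : 1 ≤ P.τ⁻¹ := (one_le_inv₀ hτ).2 hP.τ_lt_one.le
        have h2 : 0 < P.τ ^ k * P.δ₀ := by positivity
        rw [pow_succ]
        nlinarith [hP.τ_lt_one]
      · refine le_trans ?_ hP.δ₀_le_δmax
        exact mul_le_of_le_one_left h0.le (pow_le_one₀ hτ.le hP.τ_lt_one.le)
    · rw [δ_succ_of_not_successful h, pow_succ']
      nlinarith

lemma δ_pos (hP : P.Admissible) (k : ℕ) (ω : Ω) : 0 < R.δ P x₀ k ω :=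
  lt_of_lt_of_le (mul_pos (pow_pos hP.τ_pos k) hP.δ₀_pos) (pow_mul_le_δ hP k ω)

lemma τ_mul_δ_le_δ_succ (hP : P.Admissible) (k : ℕ) (ω : Ω) :
    P.τ * R.δ P x₀ k ω ≤ R.δ P x₀ (k + 1) ω := by
  have hd := δ_pos (R := R) (x₀ := x₀) hP k ω
  have hτ := hP.τ_pos
  have hm := δ_le_δmax (R := R) (x₀ := x₀) hP k ω
  by_cases h : ω ∈ R.successful P x₀ k
  · rw [δ_succ_of_successful h]
    have h1 : 1 ≤ P.τ⁻¹ := (one_le_inv₀ hτ).2 hP.τ_lt_one.le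
    refine le_min ?_ ?_ <;> nlinarith [hP.τ_lt_one]
  · rw [δ_succ_of_not_successful h]

/-! ### Measurability -/

lemma measurable_toEuclideanLin_apply {q r : ℕ} :
    Measurable fun z : Matrix (Fin q) (Fin r) ℝ × Vec r => Matrix.toEuclideanLin z.1 z.2 := by
  have hM : ∀ i j, Measurable fun M : Matrix (Fin q) (Fin r) ℝ => M i j := fun i j =>
    (measurable_pi_apply j).comp (measurable_pi_apply (X := fun _ : Fin q => Fin r → ℝ) i)
  refine (WithLp.measurable_toLp 2 (Fin q → ℝ)).comp (measurable_pi_lambda _ fun i => ?_)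
  change Measurable fun z : Matrix (Fin q) (Fin r) ℝ × Vec r => ∑ j, z.1 i j * z.2 j
  refine Finset.measurable_sum _ fun j _ => ?_
  refine ((hM i j).comp measurable_fst).mul ?_
  exact (measurable_pi_apply j).comp
    ((WithLp.measurable_ofLp 2 (Fin r → ℝ)).comp measurable_snd)

lemma measurable_transpose {q r : ℕ} :
    Measurable (Matrix.transpose : Matrix (Fin q) (Fin r) ℝ → Matrix (Fin r) (Fin q) ℝ) :=
  measurable_pi_lambda (X := fun _ : Fin r => Fin q → ℝ) _ fun i =>
    measurable_pi_lambda _ fun j =>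
    (measurable_pi_apply i).comp (measurable_pi_apply (X := fun _ : Fin q => Fin r → ℝ) j)

lemma measurable_smul_matrix {q r : ℕ} (c : ℝ) :
    Measurable fun M : Matrix (Fin q) (Fin r) ℝ => c • M :=
  measurable_pi_lambda (X := fun _ : Fin q => Fin r → ℝ) _ fun i =>
    measurable_pi_lambda _ fun j =>
    ((measurable_pi_apply j).comp
      (measurable_pi_apply (X := fun _ : Fin q => Fin r → ℝ) i)).const_mul c

/-- The history is generated by `Q`, not `U`; undoing the scaling makes the poll directions
measurable with respect to it. -/
lemma Usub_eq (hp : 1 ≤ p) (k : ℕ) :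
    R.Usub k = fun ω => (√((n : ℝ) / (p : ℝ)))⁻¹ • R.Q k ω := by
  funext ω
  have hn : 1 ≤ n := hp.trans R.p_le_n
  have : √((n : ℝ) / (p : ℝ)) ≠ 0 := by positivity
  rw [Q, smul_smul, inv_mul_cancel₀ this, one_smul]

lemma measurable_pollDir {_ : MeasurableSpace Ω} (hp : 1 ≤ p) {k : ℕ}
    (hQ : Measurable (R.Q k)) (hD : Measurable (R.D k)) (j : Fin m) :
    Measurable (R.pollDir k j) := by
  have hU : Measurable (R.Usub k) := by
    rw [Usub_eq hp]; exact (measurable_smul_matrix _).comp hQ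
  have hDj : Measurable fun ω => R.D k ω j := (measurable_pi_apply j).comp hD
  have h := (measurable_toEuclideanLin_apply (q := n) (r := p)).comp (hU.prodMk hDj)
  unfold pollDir
  simpa only [Function.comp_def] using h

lemma measurable_apply_pick {m' : MeasurableSpace Ω} {β : Type*} [MeasurableSpace β]
    {g : Fin m → Ω → β} (hg : ∀ j, Measurable (g j)) {J : Ω → Fin m} (hJ : Measurable J) :
    Measurable fun ω => g (J ω) ω := by
  have : Measurable fun z : Fin m × Ω => g z.1 z.2 := measurable_from_prod_countable_right hg
  exact this.comp (hJ.prodMk measurable_id)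

lemma measurable_step {m' : MeasurableSpace Ω} (hp : 1 ≤ p) {k : ℕ}
    (h0 : Measurable (R.est₀ k)) (h1 : ∀ j, Measurable (R.est k j))
    (hQ : Measurable (R.Q k)) (hD : Measurable (R.D k)) (hJ : Measurable (R.pick k))
    {s : Ω → Vec n × ℝ} (hs : Measurable s) :
    Measurable fun ω => R.step P k ω (s ω) := by
  classical
  unfold step
  have hpoll := measurable_apply_pick (fun j => measurable_pollDir hp hQ hD j) hJ
  refine Measurable.ite ?_ ?_ ?_
  · rw [Set.ofPred_exists]
    exact MeasurableSet.iUnion fun j => measurableSet_le ((h1 j).sub h0)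
      ((hs.snd.pow_const 2).const_mul _).neg
  · exact (hs.fst.add (hs.snd.smul hpoll)).prodMk ((hs.snd.const_mul _).min measurable_const)
  · exact hs.fst.prodMk (hs.snd.const_mul _)

lemma past_mono {k l : ℕ} (h : k ≤ l) : R.past k ≤ R.past l :=
  iSup_mono fun _ => iSup_mono' fun hi => ⟨hi.trans_le h, le_rfl⟩

section Past

variable (R) {k l : ℕ} (h : l < k)
include h

lemma gen_le_past :
    MeasurableSpace.comap (R.est₀ l) inferInstance ⊔
    (⨆ j : Fin m, MeasurableSpace.comap (R.est l j) inferInstance) ⊔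
    MeasurableSpace.comap (R.Q l) inferInstance ⊔
    MeasurableSpace.comap (R.D l) inferInstance ≤ R.past k :=
  le_iSup₂_of_le (f := fun ℓ (_ : ℓ < k) => MeasurableSpace.comap (R.est₀ ℓ) inferInstance ⊔
    (⨆ j : Fin m, MeasurableSpace.comap (R.est ℓ j) inferInstance) ⊔
    MeasurableSpace.comap (R.Q ℓ) inferInstance ⊔
    MeasurableSpace.comap (R.D ℓ) inferInstance) l h le_rfl

lemma measurable_est₀_past : Measurable[R.past k] (R.est₀ l) :=
  Measurable.of_comap_le <| le_trans (le_sup_left.trans (le_sup_left.trans le_sup_left))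
    (R.gen_le_past h)

lemma measurable_est_past (j : Fin m) : Measurable[R.past k] (R.est l j) :=
  Measurable.of_comap_le <| le_trans
    ((le_iSup (fun j => MeasurableSpace.comap (R.est l j) inferInstance) j).trans
      (le_sup_right.trans (le_sup_left.trans le_sup_left)))
    (R.gen_le_past h)

lemma measurable_Q_past : Measurable[R.past k] (R.Q l) :=
  Measurable.of_comap_le <| le_trans (le_sup_right.trans le_sup_left) (R.gen_le_past h)

lemma measurable_D_past : Measurable[R.past k] (R.D l) :=
  Measurable.of_comap_le <| le_trans le_sup_right (R.gen_le_past h)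

end Past

lemma past_le_pastQD (k : ℕ) : R.past k ≤ R.pastQD k := le_sup_left.trans le_sup_left

lemma measurable_Q_pastQD (k : ℕ) : Measurable[R.pastQD k] (R.Q k) :=
  Measurable.of_comap_le (le_sup_right.trans le_sup_left)

variable [mΩ : MeasurableSpace Ω] {μ : Measure Ω} {αQ βQ : ℝ}

lemma IsRun.measurable_Q (hR : R.IsRun μ P x₀ αQ βQ) (k : ℕ) : Measurable (R.Q k) := by
  have hU := (hR.haar k).measurable
  refine measurable_pi_lambda (X := fun _ : Fin n => Fin p → ℝ) _ fun i =>
    measurable_pi_lambda _ fun j => ?_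
  have : Measurable fun ω => (R.U k ω : Matrix (Fin n) (Fin n) ℝ) i (Fin.castLE R.p_le_n j) :=
    (measurable_pi_apply _).comp ((measurable_pi_apply (X := fun _ : Fin n => Fin n → ℝ) i).comp
      (measurable_subtype_coe.comp hU))
  exact this.const_mul (√((n : ℝ) / (p : ℝ)))

lemma IsRun.past_le (hR : R.IsRun μ P x₀ αQ βQ) (k : ℕ) : R.past k ≤ mΩ :=
  iSup₂_le fun l _ => sup_le (sup_le (sup_le (hR.measurable_est₀ l).comap_le
    (iSup_le fun j => (hR.measurable_est l j).comap_le)) (hR.measurable_Q l).comap_le)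
    (hR.measurable_D l).comap_le

lemma IsRun.pastQD_le (hR : R.IsRun μ P x₀ αQ βQ) (k : ℕ) : R.pastQD k ≤ mΩ :=
  sup_le (sup_le (hR.past_le k) (hR.measurable_Q k).comap_le) (hR.measurable_D k).comap_le

lemma IsRun.measurable_state (hR : R.IsRun μ P x₀ αQ βQ) (hp : 1 ≤ p) (k : ℕ) :
    Measurable[R.past k] (R.state P x₀ k) := by
  induction k with
  | zero => exact @measurable_const _ _ _ (R.past 0) _
  | succ k ih =>
    have hk := k.lt_succ_self
    exact measurable_step (m' := R.past (k + 1)) hp (R.measurable_est₀_past hk)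
      (R.measurable_est_past hk) (R.measurable_Q_past hk) (R.measurable_D_past hk)
      -- The selected direction is known only at the end of iteration `k`, which is exactly the
      -- history `past (k + 1)` that the next state may use.
      (hR.measurable_pick k) (ih.mono (past_mono k.le_succ) le_rfl)

lemma IsRun.measurable_x (hR : R.IsRun μ P x₀ αQ βQ) (hp : 1 ≤ p) (k : ℕ) :
    Measurable[R.past k] (R.x P x₀ k) :=
  measurable_fst.comp (hR.measurable_state hp k)

lemma IsRun.measurable_δ (hR : R.IsRun μ P x₀ αQ βQ) (hp : 1 ≤ p) (k : ℕ) :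
    Measurable[R.past k] (R.δ P x₀ k) :=
  measurable_snd.comp (hR.measurable_state hp k)

lemma IsRun.measurableSet_successful (hR : R.IsRun μ P x₀ αQ βQ) (hp : 1 ≤ p) (k : ℕ) :
    MeasurableSet (R.successful P x₀ k) := by
  have hδ := (hR.measurable_δ hp k).mono (hR.past_le k) le_rfl
  rw [successful, Set.ofPred_exists]
  exact MeasurableSet.iUnion fun j => measurableSet_le
    ((hR.measurable_est k j).sub (hR.measurable_est₀ k))
    ((hδ.pow_const 2).const_mul _).neg

lemma IsRun.measurableSet_accurate (hR : R.IsRun μ P x₀ αQ βQ) (hp : 1 ≤ p) {f : Vec n → ℝ}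
    (hf : Continuous f) (k : ℕ) : MeasurableSet (R.accurate P x₀ f k) := by
  have hδ := (hR.measurable_δ hp k).mono (hR.past_le k) le_rfl
  have hx := (hR.measurable_x hp k).mono (hR.past_le k) le_rfl
  have hb := (hδ.pow_const 2).const_mul P.εf
  rw [Inputs.accurate, Set.ofPred_and, Set.ofPred_forall]
  refine MeasurableSet.inter (measurableSet_le ?_ hb) ?_
  · exact ((hR.measurable_est₀ k).sub (hf.measurable.comp hx)).abs
  · refine MeasurableSet.iInter fun j => measurableSet_le ?_ hb
    exact ((hR.measurable_est k j).sub (hf.measurable.comp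
      (hx.add (hδ.smul (measurable_pollDir hp (hR.measurable_Q k) (hR.measurable_D k) j))))).abs

end Inputs

end StoDARS

/-! ### Deterministic part: when a small stepsize forces success -/

namespace StoDARS

/-- A descent inequality for functions with Lipschitz gradient. -/
lemma le_add_inner_gradient_add {E : Type*} [NormedAddCommGroup E] [InnerProductSpace ℝ E]
    [CompleteSpace E] {f : E → ℝ} {L : ℝ≥0} (hf : Differentiable ℝ f)
    (hL : LipschitzWith L (∇ f)) (y v : E) :
    f (y + v) ≤ f y + inner ℝ (∇ f y) v + L * ‖v‖ ^ 2 := by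
  -- With the linear part removed, the derivative along the segment is at most `L ‖v‖ ^ 2` and the
  -- mean value inequality applies. This gives `L` instead of the sharp `L / 2`, which is enough
  -- here.
  have hder : ∀ t : ℝ, HasDerivAt (fun t : ℝ => f (y + t • v) - t * inner ℝ (∇ f y) v)
      (inner ℝ (∇ f (y + t • v) - ∇ f y) v) t := by
    intro t
    have h1 : HasDerivAt (fun t : ℝ => y + t • v) v t := by
      simpa using ((hasDerivAt_id t).smul_const v).const_add y
    have h2 := (hf (y + t • v)).hasFDerivAt.comp_hasDerivAt t h1
    have h3 := (hasDerivAt_id t).mul_const (inner ℝ (∇ f y) v)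
    refine (h2.sub h3).congr_deriv ?_
    simp only [inner_sub_left, inner_gradient_left, one_mul]
  have hb : ∀ t ∈ Set.Ico (0 : ℝ) 1,
      ‖inner ℝ (∇ f (y + t • v) - ∇ f y) v‖ ≤ L * ‖v‖ ^ 2 := by
    intro t ht
    have h1 : ‖∇ f (y + t • v) - ∇ f y‖ ≤ L * ‖v‖ := by
      refine (hL.norm_sub_le _ _).trans ?_
      rw [add_sub_cancel_left, norm_smul, Real.norm_of_nonneg ht.1]
      gcongr
      exact mul_le_of_le_one_left (norm_nonneg _) ht.2.le
    calc _ ≤ ‖∇ f (y + t • v) - ∇ f y‖ * ‖v‖ := norm_inner_le_norm _ _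
      _ ≤ L * ‖v‖ * ‖v‖ := by gcongr
      _ = _ := by ring
  have h := norm_image_sub_le_of_norm_deriv_le_segment_01'
    (fun t _ => (hder t).hasDerivWithinAt) hb
  have h' := (le_abs_self _).trans h
  simp only [one_smul, one_mul, zero_smul, zero_mul, add_zero, sub_zero] at h'
  linarith

lemma inner_toEuclideanLin {q r : ℕ} (M : Matrix (Fin q) (Fin r) ℝ) (v : Vec r) (w : Vec q) :
    inner ℝ w (Matrix.toEuclideanLin M v) =
      inner ℝ (Matrix.toEuclideanLin M.transpose w) v := by
  have h := Matrix.toEuclideanLin_conjTranspose_eq_adjoint M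
  rw [Matrix.conjTranspose_eq_transpose_of_trivial] at h
  rw [h, LinearMap.adjoint_inner_left]

/-- A positive lower bound for the cosine measure is attained by some direction. -/
lemma exists_le_inner_of_le_cosineMeasure {q : ℕ} {ι : Type*} [Finite ι] [Nonempty ι]
    {d : ι → Vec q} {κ : ℝ} (hκ0 : 0 < κ) (hκ : κ ≤ cosineMeasure (Set.range d))
    (hd : ∀ j, ‖d j‖ = 1) (w : Vec q) : ∃ j, κ * ‖w‖ ≤ inner ℝ w (d j) := by
  by_cases hw : w = 0
  · simp [hw]
  -- A real infimum over a family unbounded below is zero by convention, which would contradict `0 <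
  -- κ`.
  have hbdd : BddBelow (Set.range fun w : {w : Vec q // w ≠ 0} => ⨆ d : Set.range d,
      inner ℝ (w : Vec q) (d : Vec q) / (‖(w : Vec q)‖ * ‖(d : Vec q)‖)) := by
    by_contra hb
    rw [cosineMeasure, Real.iInf_of_not_bddBelow hb] at hκ
    linarith
  have h1 := hκ.trans (ciInf_le hbdd ⟨w, hw⟩)
  obtain ⟨⟨_, j, rfl⟩, hj⟩ := exists_eq_ciSup_of_finite
    (f := fun e : Set.range d => inner ℝ w (e : Vec q) / (‖w‖ * ‖(e : Vec q)‖))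
  rw [← hj] at h1
  simp only [hd, mul_one] at h1
  exact ⟨j, (le_div_iff₀ (norm_pos_iff.2 hw)).1 h1⟩

namespace Inputs

variable {P : Params} {Ω : Type*} {n p m : ℕ} {R : Inputs Ω n p m} {x₀ : Vec n}

lemma Usub_transpose_mul_self (k : ℕ) (ω : Ω) :
    (R.Usub k ω).transpose * R.Usub k ω = 1 := by
  have h := (Matrix.mem_orthogonalGroup_iff' _ _).1 (R.U k ω).2
  ext i j
  have h' := congrFun (congrFun h (Fin.castLE R.p_le_n i)) (Fin.castLE R.p_le_n j)
  rw [Matrix.mul_apply] at h' ⊢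
  simp only [Matrix.one_apply, Fin.castLE_inj] at h' ⊢
  exact h'

lemma norm_pollDir (k : ℕ) (j : Fin m) (ω : Ω) : ‖R.pollDir k j ω‖ = ‖R.D k ω j‖ := by
  have h : inner ℝ (R.pollDir k j ω) (R.pollDir k j ω) = inner ℝ (R.D k ω j) (R.D k ω j) := by
    unfold pollDir
    rw [inner_toEuclideanLin]
    congr 1
    simp [Matrix.toLpLin_apply, Matrix.mulVec_mulVec, Usub_transpose_mul_self]
  rw [real_inner_self_eq_norm_sq, real_inner_self_eq_norm_sq] at h
  exact (pow_left_inj₀ (norm_nonneg _) (norm_nonneg _) two_ne_zero).1 h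

/-- With an aligned subspace, accurate estimates and a small stepsize the iteration succeeds. -/
lemma mem_successful_of_accurate (hP : P.Admissible) (hp : 1 ≤ p) [Nonempty (Fin m)]
    {f : Vec n → ℝ} {L : ℝ≥0} (hf : Differentiable ℝ f) (hL : LipschitzWith L (∇ f))
    {α κ ε : ℝ} (hα : 0 < α) (hκ0 : 0 < κ) {k : ℕ} {ω : Ω}
    (hD : ∀ j, ‖R.D k ω j‖ = 1) (hκ : κ ≤ cosineMeasure (Set.range (R.D k ω)))
    (hal : α * ‖∇ f (R.x P x₀ k ω)‖ ≤
      ‖Matrix.toEuclideanLin (R.Q k ω).transpose (∇ f (R.x P x₀ k ω))‖)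
    (hacc : ω ∈ R.accurate P x₀ f k) (hg : ε < ‖∇ f (R.x P x₀ k ω)‖)
    (hδ : R.δ P x₀ k ω * (√((n : ℝ) / p) * (L + (P.γ + 2) * P.εf)) ≤ κ * α * ε) :
    ω ∈ R.successful P x₀ k := by
  set g := ∇ f (R.x P x₀ k ω) with hgdef
  set δ := R.δ P x₀ k ω with hδdef
  set c := √((n : ℝ) / p) with hc
  have hn : 1 ≤ n := hp.trans R.p_le_n
  have hc0 : 0 < c := by positivity
  have hδ0 : 0 < δ := δ_pos hP k ω
  -- The cosine measure is applied in the subspace, to the negative projected gradient: some poll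
  -- direction is a descent direction of quantified quality.
  obtain ⟨j, hj⟩ := exists_le_inner_of_le_cosineMeasure hκ0 hκ hD
    (-Matrix.toEuclideanLin (R.Q k ω).transpose g)
  -- Alignment concerns `Q`, polling uses `U`; the factor `c` between them is why `√(n/p)`
  -- multiplies the whole threshold in `hδ`.
  have hQ : inner ℝ (Matrix.toEuclideanLin (R.Q k ω).transpose g) (R.D k ω j) =
      c * inner ℝ g (R.pollDir k j ω) := by
    rw [← inner_toEuclideanLin, Q, map_smul, LinearMap.smul_apply, inner_smul_right]
    rfl
  rw [inner_neg_left, norm_neg, hQ] at hj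
  have h1 : κ * α * ε ≤ -(c * inner ℝ g (R.pollDir k j ω)) := by
    refine le_trans ?_ hj
    rw [mul_assoc]
    gcongr
    exact le_trans (by gcongr) hal
  have h2 : δ * (L + (P.γ + 2) * P.εf) ≤ -inner ℝ g (R.pollDir k j ω) := by
    refine le_of_mul_le_mul_left ?_ hc0
    linarith
  have h3 := le_add_inner_gradient_add hf hL (R.x P x₀ k ω) (δ • R.pollDir k j ω)
  rw [norm_smul, norm_pollDir, hD, inner_smul_right, Real.norm_of_nonneg hδ0.le, mul_one,
    ← hgdef] at h3
  have h4 := abs_le.1 hacc.1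
  have h5 := abs_le.1 (hacc.2 j)
  have h6 := mul_le_mul_of_nonneg_left h2 hδ0.le
  refine ⟨j, ?_⟩
  rw [← hδdef] at h4 h5 ⊢
  -- The true decrease is at least `(γ + 2) εf δ ^ 2`; the two estimation errors cost at most `2 εf
  -- δ ^ 2` of it.
  nlinarith [h4.1, h4.2, h5.1, h5.2]

end Inputs

/-! ### Consequences of bounds for conditional expectations -/

section CondExp

variable {Ω : Type*} {m mΩ : MeasurableSpace Ω} {μ : Measure Ω} [IsProbabilityMeasure μ]

/-- The weight is pulled into the conditional expectation, which is then integrated away. -/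
lemma integral_mul_le_of_le_condExp (hm : m ≤ mΩ) {w X Y : Ω → ℝ} (hw : Measurable[m] w)
    (hw0 : ∀ ω, 0 ≤ w ω) {c : ℝ} (hwc : ∀ ω, w ω ≤ c) (hX : Integrable X μ)
    (hY : Integrable Y μ) (h : ∀ᵐ ω ∂μ, Y ω ≤ (μ[X | m]) ω) :
    ∫ ω, w ω * Y ω ∂μ ≤ ∫ ω, w ω * X ω ∂μ := by
  have hb : ∀ᵐ ω ∂μ, ‖w ω‖ ≤ c :=
    ae_of_all _ fun ω => by rw [Real.norm_of_nonneg (hw0 ω)]; exact hwc ω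
  have hws : AEStronglyMeasurable w μ := (hw.mono hm le_rfl).aestronglyMeasurable
  have h1 := condExp_stronglyMeasurable_mul_of_bound hm hw.stronglyMeasurable hX c hb
  calc ∫ ω, w ω * Y ω ∂μ ≤ ∫ ω, w ω * (μ[X | m]) ω ∂μ := by
        refine integral_mono_ae (hY.bdd_mul hws hb) (integrable_condExp.bdd_mul hws hb) ?_
        filter_upwards [h] with ω hω
        exact mul_le_mul_of_nonneg_left hω (hw0 ω)
    _ = ∫ ω, (μ[w * X | m]) ω ∂μ := integral_congr_ae h1.symm
    _ = _ := integral_condExp hm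

lemma integral_mul_le_of_condExp_le (hm : m ≤ mΩ) {w X Y : Ω → ℝ} (hw : Measurable[m] w)
    (hw0 : ∀ ω, 0 ≤ w ω) {c : ℝ} (hwc : ∀ ω, w ω ≤ c) (hX : Integrable X μ)
    (hY : Integrable Y μ) (h : ∀ᵐ ω ∂μ, (μ[X | m]) ω ≤ Y ω) :
    ∫ ω, w ω * X ω ∂μ ≤ ∫ ω, w ω * Y ω ∂μ := by
  have h1 := integral_mul_le_of_le_condExp hm hw hw0 hwc hX.neg hY.neg (by
    filter_upwards [h, condExp_neg X m (μ := μ)] with ω h1 h2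
    rw [h2]
    exact neg_le_neg h1)
  simpa [integral_neg] using h1

end CondExp

end StoDARS

/-! ### Expected decrease of the merit function -/

namespace StoDARS

namespace Inputs

variable {P : Params} {Ω : Type*} {n p m : ℕ} {R : Inputs Ω n p m} {x₀ : Vec n}
variable {f : Vec n → ℝ} {fmin ν βf : ℝ}

/-- The merit function `(ν / εf) (f x_k - fmin) + (1 - ν) δ_k ^ 2`. -/
noncomputable def merit (R : Inputs Ω n p m) (P : Params) (x₀ : Vec n) (f : Vec n → ℝ)
    (fmin ν : ℝ) (k : ℕ) (ω : Ω) : ℝ :=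
  ν / P.εf * (f (R.x P x₀ k ω) - fmin) + (1 - ν) * R.δ P x₀ k ω ^ 2

lemma merit_zero (ω : Ω) : R.merit P x₀ f fmin ν 0 ω = phiZero P x₀ f fmin ν := rfl

lemma merit_nonneg (hP : P.Admissible) (hν : 0 < ν) (hν1 : ν < 1) (hmin : ∀ y, fmin ≤ f y)
    (k : ℕ) (ω : Ω) : 0 ≤ R.merit P x₀ f fmin ν k ω := by
  have h1 := hP.εf_pos
  have h2 := sub_nonneg.2 (hmin (R.x P x₀ k ω))
  have h3 := sub_pos.2 hν1
  unfold merit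
  positivity

section Pointwise

variable {k : ℕ} {ω : Ω}
  (hpick : ω ∈ R.successful P x₀ k →
    R.est k (R.pick k ω) ω - R.est₀ k ω ≤ -(P.γ * P.εf * R.δ P x₀ k ω ^ 2))
include hpick

/-- A crude bound whose purpose is the integrability of `f (x_k)`, by induction on `k`. -/
lemma f_x_succ_le (hP : P.Admissible) :
    f (R.x P x₀ (k + 1) ω) ≤
      f (R.x P x₀ k ω) + |R.err₀ P x₀ f k ω| + |R.err P x₀ f k ω| := by
  by_cases h : ω ∈ R.successful P x₀ k
  · have h1 := hpick h
    have h2 : 0 ≤ P.γ * P.εf * R.δ P x₀ k ω ^ 2 :=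
      mul_nonneg (mul_nonneg (by linarith [hP.two_lt_γ]) hP.εf_pos.le) (sq_nonneg _)
    have h3 := le_abs_self (R.err₀ P x₀ f k ω)
    have h4 := neg_abs_le (R.err P x₀ f k ω)
    rw [x_succ_of_successful h]
    unfold err₀ err at *
    linarith
  · rw [x_succ_of_not_successful h, add_assoc]
    exact le_add_of_nonneg_right (by positivity)

/-- Here `a` is the estimation error beyond the tolerance `2 εf δ ^ 2`. Failure shrinks the stepsize
and yields the decrease directly. On success the decrease of `f` pays twice for the growth of `δ ^
2`, by the choice of `ν`, and the surplus is at least as large as the decrease after a failure. -/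
lemma merit_succ_le_aux (hP : P.Admissible) (hν : 0 < ν) (hν1 : ν < 1)
    (hν2 : 2 * ((P.τ ^ 2)⁻¹ - 1) / (P.γ - 2) ≤ ν / (1 - ν)) {a : ℝ}
    (ha : |R.err₀ P x₀ f k ω| + |R.err P x₀ f k ω| ≤
      a + 2 * (P.εf * R.δ P x₀ k ω ^ 2)) (ha0 : 0 ≤ a) :
    R.merit P x₀ f fmin ν (k + 1) ω ≤ R.merit P x₀ f fmin ν k ω -
      (1 - ν) * (1 - P.τ ^ 2) * R.δ P x₀ k ω ^ 2 + ν / P.εf * a := by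
  have hε := hP.εf_pos
  have hτ := hP.τ_pos
  have hτ1 := hP.τ_lt_one
  have hγ := sub_pos.2 hP.two_lt_γ
  have hν3 := sub_pos.2 hν1
  have hδ : 0 < R.δ P x₀ k ω := δ_pos hP k ω
  have hνε : 0 < ν / P.εf := by positivity
  by_cases h : ω ∈ R.successful P x₀ k
  · have h1 := hpick h
    have h3 := le_abs_self (R.err₀ P x₀ f k ω)
    have h4 := neg_abs_le (R.err P x₀ f k ω)
    have hf1 : f (R.x P x₀ (k + 1) ω) - f (R.x P x₀ k ω) ≤
        a - (P.γ - 2) * P.εf * R.δ P x₀ k ω ^ 2 := by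
      rw [x_succ_of_successful h]
      unfold err₀ err at *
      linarith
    have hδ1 : R.δ P x₀ (k + 1) ω ^ 2 ≤ (P.τ ^ 2)⁻¹ * R.δ P x₀ k ω ^ 2 := by
      rw [← inv_pow, ← mul_pow]
      refine pow_le_pow_left₀ (δ_pos hP _ _).le ?_ 2
      rw [δ_succ_of_successful h]
      exact min_le_left _ _
    rw [div_le_div_iff₀ hγ hν3] at hν2
    have hτ2 : P.τ ^ 2 < 1 := pow_lt_one₀ hτ.le hτ1 two_ne_zero
    have hτ3 : 1 - P.τ ^ 2 ≤ (P.τ ^ 2)⁻¹ - 1 := by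
      have h5 : P.τ ^ 2 * (P.τ ^ 2)⁻¹ = 1 := mul_inv_cancel₀ (by positivity)
      have h6 : 0 < (P.τ ^ 2)⁻¹ := by positivity
      nlinarith [sq_nonneg (P.τ ^ 2 - 1)]
    have hf2 := mul_le_mul_of_nonneg_left hf1 hνε.le
    have hf3 : ν / P.εf * (a - (P.γ - 2) * P.εf * R.δ P x₀ k ω ^ 2) =
        ν / P.εf * a - ν * (P.γ - 2) * R.δ P x₀ k ω ^ 2 := by
      field_simp
    have hδ2 := mul_le_mul_of_nonneg_left hδ1 hν3.le
    have hcoef : (1 - ν) * ((P.τ ^ 2)⁻¹ - 1) - ν * (P.γ - 2) ≤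
        -((1 - ν) * (1 - P.τ ^ 2)) := by
      have := mul_le_mul_of_nonneg_left hτ3 hν3.le
      linarith
    have h7 := mul_le_mul_of_nonneg_right hcoef (sq_nonneg (R.δ P x₀ k ω))
    unfold merit
    linarith
  · unfold merit
    rw [x_succ_of_not_successful h, δ_succ_of_not_successful h]
    have : 0 ≤ ν / P.εf * a := by positivity
    linarith

/-- Pathwise change of the merit function in one iteration. -/
lemma merit_succ_le (hP : P.Admissible) (hν : 0 < ν) (hν1 : ν < 1)
    (hν2 : 2 * ((P.τ ^ 2)⁻¹ - 1) / (P.γ - 2) ≤ ν / (1 - ν)) :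
    R.merit P x₀ f fmin ν (k + 1) ω ≤ R.merit P x₀ f fmin ν k ω -
      (1 - ν) * (1 - P.τ ^ 2) * R.δ P x₀ k ω ^ 2 +
      ν / (2 * P.εf ^ 2) * ((R.δ P x₀ k ω ^ 2)⁻¹ * |R.err₀ P x₀ f k ω| ^ 2) +
      ν / (2 * P.εf ^ 2) * ((R.δ P x₀ k ω ^ 2)⁻¹ * |R.err P x₀ f k ω| ^ 2) +
      ν * (R.δ P x₀ k ω ^ 2 -
        R.δ P x₀ k ω ^ 2 * (R.accurate P x₀ f k).indicator (fun _ => (1 : ℝ)) ω) := by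
  have hε := hP.εf_pos
  have hδ : 0 < R.δ P x₀ k ω := δ_pos hP k ω
  by_cases hJ : ω ∈ R.accurate P x₀ f k
  · have h1 := merit_succ_le_aux (fmin := fmin) (a := 0) hpick hP hν hν1 hν2
      (by linarith [show |R.err₀ P x₀ f k ω| ≤ _ from hJ.1,
        show |R.err P x₀ f k ω| ≤ _ from hJ.2 (R.pick k ω)]) le_rfl
    rw [Set.indicator_of_mem hJ, mul_one, sub_self, mul_zero]
    refine h1.trans ?_
    rw [mul_zero, add_zero, add_zero]
    have : 0 ≤ ν / (2 * P.εf ^ 2) * ((R.δ P x₀ k ω ^ 2)⁻¹ * |R.err₀ P x₀ f k ω| ^ 2) := by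
      positivity
    have : 0 ≤ ν / (2 * P.εf ^ 2) * ((R.δ P x₀ k ω ^ 2)⁻¹ * |R.err P x₀ f k ω| ^ 2) := by
      positivity
    linarith
  · have h1 := merit_succ_le_aux (fmin := fmin) hpick hP hν hν1 hν2
      (a := |R.err₀ P x₀ f k ω| + |R.err P x₀ f k ω|)
      (le_add_of_nonneg_right (by positivity)) (by positivity)
    rw [Set.indicator_of_notMem hJ, mul_zero, sub_zero]
    -- Young's inequality, weighted by `1 / δ ^ 2` because the error has second moment of order `δ ^
    -- 4`. The two remainders `ν / 2 * δ ^ 2` make up the term charged to inaccurate iterations.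
    have key : ∀ e : ℝ, ν / P.εf * e ≤
        ν / (2 * P.εf ^ 2) * ((R.δ P x₀ k ω ^ 2)⁻¹ * e ^ 2) + ν / 2 * R.δ P x₀ k ω ^ 2 := by
      intro e
      have : ν / (2 * P.εf ^ 2) * ((R.δ P x₀ k ω ^ 2)⁻¹ * e ^ 2) + ν / 2 * R.δ P x₀ k ω ^ 2 -
          ν / P.εf * e = ν / 2 * (e / (P.εf * R.δ P x₀ k ω) - R.δ P x₀ k ω) ^ 2 := by
        field_simp
        ring
      have h2 : 0 ≤ ν / 2 * (e / (P.εf * R.δ P x₀ k ω) - R.δ P x₀ k ω) ^ 2 := by positivity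
      linarith
    have h2 := key |R.err₀ P x₀ f k ω|
    have h3 := key |R.err P x₀ f k ω|
    linarith

end Pointwise

variable [mΩ : MeasurableSpace Ω] {μ : Measure Ω} [IsProbabilityMeasure μ] {αQ βQ : ℝ}

lemma IsRun.integrable_δ_sq (hR : R.IsRun μ P x₀ αQ βQ) (hP : P.Admissible) (hp : 1 ≤ p)
    (k : ℕ) : Integrable (fun ω => R.δ P x₀ k ω ^ 2) μ := by
  refine Integrable.of_bound
    (((hR.measurable_δ hp k).mono (hR.past_le k) le_rfl).pow_const 2).aestronglyMeasurable
    (P.δmax ^ 2) (ae_of_all _ fun ω => ?_)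
  rw [Real.norm_of_nonneg (sq_nonneg _)]
  exact pow_le_pow_left₀ (δ_pos hP k ω).le (δ_le_δmax hP k ω) 2

lemma IsRun.integrable_f_x (hR : R.IsRun μ P x₀ αQ βQ) (hP : P.Admissible) (hp : 1 ≤ p)
    (hf : Continuous f) (hmin : ∀ y, fmin ≤ f y) (hest : R.EstimatesOK μ P x₀ f βf) (k : ℕ) :
    Integrable (fun ω => f (R.x P x₀ k ω)) μ := by
  induction k with
  | zero => exact integrable_const (f x₀)
  | succ k ih =>
    have h0 := ((hest.memLp_err₀ k).integrable one_le_two).abs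
    have h1 := ((hest.memLp_err k).integrable one_le_two).abs
    refine (((ih.abs.add h0).add h1).add (integrable_const |fmin|)).mono'
      (hf.measurable.comp
        ((hR.measurable_x hp (k + 1)).mono (hR.past_le _) le_rfl)).aestronglyMeasurable
      (ae_of_all _ fun ω => ?_)
    have h2 := f_x_succ_le (f := f) (hR.pick_spec k ω) hP
    have h3 := hmin (R.x P x₀ (k + 1) ω)
    simp only [Pi.add_apply, Real.norm_eq_abs]
    have h4 := neg_abs_le fmin
    have h5 := le_abs_self (f (R.x P x₀ k ω))
    have h6 := abs_nonneg (R.err₀ P x₀ f k ω)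
    have h7 := abs_nonneg (R.err P x₀ f k ω)
    have h8 := abs_nonneg fmin
    have h9 := abs_nonneg (f (R.x P x₀ k ω))
    exact abs_le.2 ⟨by linarith, by linarith⟩

lemma IsRun.integrable_merit (hR : R.IsRun μ P x₀ αQ βQ) (hP : P.Admissible) (hp : 1 ≤ p)
    (hf : Continuous f) (hmin : ∀ y, fmin ≤ f y) (hest : R.EstimatesOK μ P x₀ f βf) (k : ℕ) :
    Integrable (R.merit P x₀ f fmin ν k) μ :=
  (((hR.integrable_f_x hP hp hf hmin hest k).sub (integrable_const _)).const_mul _).add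
    ((hR.integrable_δ_sq hP hp k).const_mul _)

/-- The weight `1 / δ_k ^ 2` is known before the estimates are drawn, so it can be tested against
the variance condition and turns `δ_k ^ 4` into `δ_k ^ 2`. -/
lemma IsRun.integral_inv_mul_sq_le (hR : R.IsRun μ P x₀ αQ βQ) (hP : P.Admissible)
    (hp : 1 ≤ p) {k : ℕ} {e : Ω → ℝ} {C : ℝ} (he : MemLp e 2 μ)
    (hvar : ∀ᵐ ω ∂μ, (μ[fun ω' => |e ω'| ^ 2 | R.pastQD k]) ω ≤ C * R.δ P x₀ k ω ^ 4) :
    Integrable (fun ω => (R.δ P x₀ k ω ^ 2)⁻¹ * |e ω| ^ 2) μ ∧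
    ∫ ω, (R.δ P x₀ k ω ^ 2)⁻¹ * |e ω| ^ 2 ∂μ ≤ C * ∫ ω, R.δ P x₀ k ω ^ 2 ∂μ := by
  have hδ0 : ∀ ω, 0 < R.δ P x₀ k ω := δ_pos hP k
  have hlow : 0 < P.τ ^ k * P.δ₀ := mul_pos (pow_pos hP.τ_pos k) hP.δ₀_pos
  have hw : Measurable[R.pastQD k] fun ω => (R.δ P x₀ k ω ^ 2)⁻¹ :=
    (((hR.measurable_δ hp k).mono (past_le_pastQD k) le_rfl).pow_const 2).inv
  have hw0 : ∀ ω, 0 ≤ (R.δ P x₀ k ω ^ 2)⁻¹ := fun ω => by positivity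
  have hwc : ∀ ω, (R.δ P x₀ k ω ^ 2)⁻¹ ≤ ((P.τ ^ k * P.δ₀) ^ 2)⁻¹ := fun ω => by
    have := pow_mul_le_δ (R := R) (x₀ := x₀) hP k ω
    gcongr
  have hX : Integrable (fun ω => |e ω| ^ 2) μ := by simpa using he.integrable_sq
  have hY : Integrable (fun ω => C * R.δ P x₀ k ω ^ 4) μ := by
    refine (Integrable.of_bound
      (((hR.measurable_δ hp k).mono (hR.past_le k) le_rfl).pow_const 4).aestronglyMeasurable
      (P.δmax ^ 4) (ae_of_all _ fun ω => ?_)).const_mul C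
    rw [Real.norm_of_nonneg (by have := hδ0 ω; positivity)]
    exact pow_le_pow_left₀ (hδ0 ω).le (δ_le_δmax hP k ω) 4
  constructor
  · exact hX.bdd_mul (hw.mono (hR.pastQD_le k) le_rfl).aestronglyMeasurable
      (ae_of_all _ fun ω => by rw [Real.norm_of_nonneg (hw0 ω)]; exact hwc ω)
  · refine (integral_mul_le_of_condExp_le (hR.pastQD_le k) hw hw0 hwc hX hY hvar).trans_eq ?_
    rw [← integral_const_mul]
    congr 1 with ω
    have := (hδ0 ω).ne'
    field_simp

/-- Expected decrease of the merit function. -/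
lemma IsRun.integral_merit_succ_le (hR : R.IsRun μ P x₀ αQ βQ) (hP : P.Admissible)
    (hp : 1 ≤ p) (hν : 0 < ν) (hν1 : ν < 1)
    (hν2 : 2 * ((P.τ ^ 2)⁻¹ - 1) / (P.γ - 2) ≤ ν / (1 - ν)) (hβ1 : βf < 1)
    (hβ2 : 4 * ν / ((1 - ν) * (1 - P.τ ^ 2)) ≤ βf / (1 - βf))
    (hf : Continuous f) (hmin : ∀ y, fmin ≤ f y) (hest : R.EstimatesOK μ P x₀ f βf) (k : ℕ) :
    ∫ ω, R.merit P x₀ f fmin ν (k + 1) ω ∂μ ≤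
      ∫ ω, R.merit P x₀ f fmin ν k ω ∂μ - rho P ν βf * ∫ ω, R.δ P x₀ k ω ^ 2 ∂μ := by
  have hε := hP.εf_pos
  have hδ0 : ∀ ω, 0 < R.δ P x₀ k ω := δ_pos hP k
  obtain ⟨i1, h1⟩ := hR.integral_inv_mul_sq_le hP hp (hest.memLp_err₀ k) (hest.variance₀ k)
  obtain ⟨i2, h2⟩ := hR.integral_inv_mul_sq_le hP hp (hest.memLp_err k) (hest.variance k)
  have iδ := hR.integrable_δ_sq hP hp k
  have iM := hR.integrable_merit (ν := ν) hP hp hf hmin hest k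
  have iJ : Integrable ((R.accurate P x₀ f k).indicator fun _ => (1 : ℝ)) μ :=
    (integrable_const 1).indicator (hR.measurableSet_accurate hp hf k)
  have hwc : ∀ ω, R.δ P x₀ k ω ^ 2 ≤ P.δmax ^ 2 := fun ω =>
    pow_le_pow_left₀ (hδ0 ω).le (δ_le_δmax hP k ω) 2
  have h3 := integral_mul_le_of_le_condExp (hR.pastQD_le k)
    (((hR.measurable_δ hp k).mono (past_le_pastQD k) le_rfl).pow_const 2)
    (fun ω => sq_nonneg (R.δ P x₀ k ω)) hwc iJ (integrable_const βf) (hest.accurate k)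
  have iδJ : Integrable (fun ω => R.δ P x₀ k ω ^ 2 *
      (R.accurate P x₀ f k).indicator (fun _ => (1 : ℝ)) ω) μ :=
    iJ.bdd_mul iδ.aestronglyMeasurable
      (ae_of_all _ fun ω => by rw [Real.norm_of_nonneg (sq_nonneg _)]; exact hwc ω)
  rw [integral_mul_const] at h3
  have h4 := integral_mono (hR.integrable_merit (ν := ν) hP hp hf hmin hest (k + 1))
    ((((iM.sub (iδ.const_mul ((1 - ν) * (1 - P.τ ^ 2)))).add
      (i1.const_mul (ν / (2 * P.εf ^ 2)))).add
      (i2.const_mul (ν / (2 * P.εf ^ 2)))).add ((iδ.sub iδJ).const_mul ν))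
    (fun ω => merit_succ_le (fmin := fmin) (hR.pick_spec k ω) hP hν hν1 hν2)
  rw [integral_add' (((iM.sub (iδ.const_mul _)).add (i1.const_mul _)).add (i2.const_mul _))
      ((iδ.sub iδJ).const_mul ν),
    integral_add' ((iM.sub (iδ.const_mul _)).add (i1.const_mul _)) (i2.const_mul _),
    integral_add' (iM.sub (iδ.const_mul _)) (i1.const_mul _),
    integral_sub' iM (iδ.const_mul _), integral_const_mul, integral_const_mul,
    integral_const_mul, integral_const_mul, integral_sub' iδ iδJ] at h4
  have hI : 0 ≤ ∫ ω, R.δ P x₀ k ω ^ 2 ∂μ := integral_nonneg fun ω => sq_nonneg _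
  set I := ∫ ω, R.δ P x₀ k ω ^ 2 ∂μ
  have hc : 0 ≤ ν / (2 * P.εf ^ 2) := by positivity
  have h5 := mul_le_mul_of_nonneg_left h1 hc
  have h6 := mul_le_mul_of_nonneg_left h2 hc
  have h7 := mul_le_mul_of_nonneg_left h3 hν.le
  have h8 : ν / (2 * P.εf ^ 2) * (P.εf ^ 2 * (1 - βf) * I) = ν / 2 * (1 - βf) * I := by
    field_simp
  have hτ2 : 0 < 1 - P.τ ^ 2 :=
    sub_pos.2 (pow_lt_one₀ hP.τ_pos.le hP.τ_lt_one two_ne_zero)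
  have hν3 := sub_pos.2 hν1
  rw [div_le_div_iff₀ (by positivity) (sub_pos.2 hβ1)] at hβ2
  -- The two variance terms together and the inaccuracy term each cost `ν (1 - βf)`. By the choice
  -- of `βf` this total uses at most half of `βf (1 - ν) (1 - τ ^ 2)`, leaving `rho`.
  have h9 : 2 * ν * (1 - βf) - (1 - ν) * (1 - P.τ ^ 2) ≤ -rho P ν βf := by
    have h10 : βf * ((1 - ν) * (1 - P.τ ^ 2)) ≤ (1 - ν) * (1 - P.τ ^ 2) :=
      mul_le_of_le_one_left (by positivity) hβ1.le
    unfold rho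
    linarith
  have h11 := mul_le_mul_of_nonneg_right h9 hI
  linarith

lemma IsRun.rho_mul_sum_integral_le (hR : R.IsRun μ P x₀ αQ βQ) (hP : P.Admissible)
    (hp : 1 ≤ p) (hν : 0 < ν) (hν1 : ν < 1)
    (hν2 : 2 * ((P.τ ^ 2)⁻¹ - 1) / (P.γ - 2) ≤ ν / (1 - ν)) (hβ1 : βf < 1)
    (hβ2 : 4 * ν / ((1 - ν) * (1 - P.τ ^ 2)) ≤ βf / (1 - βf))
    (hf : Continuous f) (hmin : ∀ y, fmin ≤ f y) (hest : R.EstimatesOK μ P x₀ f βf) (N : ℕ) :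
    rho P ν βf * ∑ k ∈ Finset.range N, ∫ ω, R.δ P x₀ k ω ^ 2 ∂μ ≤ phiZero P x₀ f fmin ν := by
  have h : rho P ν βf * ∑ k ∈ Finset.range N, ∫ ω, R.δ P x₀ k ω ^ 2 ∂μ +
      ∫ ω, R.merit P x₀ f fmin ν N ω ∂μ ≤ phiZero P x₀ f fmin ν := by
    induction N with
    | zero => simp [merit_zero]
    | succ N ih =>
      rw [Finset.sum_range_succ, mul_add]
      have := hR.integral_merit_succ_le hP hp hν hν1 hν2 hβ1 hβ2 hf hmin hest N
      linarith
  have h0 : 0 ≤ ∫ ω, R.merit P x₀ f fmin ν N ω ∂μ :=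
    integral_nonneg (merit_nonneg hP hν hν1 hmin N)
  linarith

end Inputs

end StoDARS

/-! ### Probability of success and drift of the log-stepsize -/

namespace StoDARS

lemma measurableSet_mul_norm_le {Ω : Type*} {m' : MeasurableSpace Ω} {n p : ℕ}
    {Q : Ω → Matrix (Fin n) (Fin p) ℝ} {v : Ω → Vec n} (hQ : Measurable Q) (hv : Measurable v)
    (α : ℝ) :
    MeasurableSet {ω | α * ‖v ω‖ ≤ ‖Matrix.toEuclideanLin (Q ω).transpose (v ω)‖} :=
  measurableSet_le (hv.norm.const_mul α) (Inputs.measurable_toEuclideanLin_apply.comp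
    ((Inputs.measurable_transpose.comp hQ).prodMk hv)).norm

lemma measurableSet_lt_norm {Ω : Type*} {m' : MeasurableSpace Ω} {n : ℕ} {v : Ω → Vec n}
    (hv : Measurable v) (ε : ℝ) : MeasurableSet {ω | ε < ‖v ω‖} :=
  measurableSet_lt measurable_const hv.norm

/-- Well alignment passes to random vectors which are independent of the matrix. -/
lemma IsWellAligned.le_measureReal_inter {Ω : Type*} {m' mΩ : MeasurableSpace Ω}
    {μ : Measure Ω} [IsProbabilityMeasure μ] {n p : ℕ} {Q : Ω → Matrix (Fin n) (Fin p) ℝ}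
    {α β : ℝ} (h : IsWellAligned μ Q α β) (hQ : Measurable Q) (hm : m' ≤ mΩ)
    (hind : Indep (MeasurableSpace.comap Q inferInstance) m' μ)
    {v : Ω → Vec n} (hv : Measurable[m'] v) {B : Set Ω} (hB : MeasurableSet[m'] B) :
    (1 - β) * μ.real B ≤
      μ.real (B ∩ {ω | α * ‖v ω‖ ≤ ‖Matrix.toEuclideanLin (Q ω).transpose (v ω)‖}) := by
  classical
  -- The event `B` is carried along as an extra coordinate, so that one application of Fubini to the
  -- product law of `Z` and `Q` reduces the claim to deterministic vectors.
  let Z : Ω → Vec n × ℝ := fun ω => (v ω, B.indicator (fun _ => (1 : ℝ)) ω)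
  have hZ' : Measurable[m'] Z :=
    Measurable.prodMk hv (Measurable.indicator (@measurable_const _ _ _ m' 1) hB)
  have hZ : Measurable Z := hZ'.mono hm le_rfl
  have hZQ : IndepFun Z Q μ := by
    rw [IndepFun_iff_Indep]
    exact indep_of_indep_of_le_left hind.symm hZ'.comap_le
  have hmap := (indepFun_iff_map_prod_eq_prod_map_map hZ.aemeasurable hQ.aemeasurable).1 hZQ
  let E : Set ((Vec n × ℝ) × Matrix (Fin n) (Fin p) ℝ) :=
    {z | z.1.2 = 1} ∩
      {z | α * ‖z.1.1‖ ≤ ‖Matrix.toEuclideanLin z.2.transpose z.1.1‖}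
  have hE : MeasurableSet E := by
    exact (measurable_fst.snd (measurableSet_singleton 1)).inter
      (measurableSet_mul_norm_le measurable_snd measurable_fst.fst α)
  have hpre : (fun ω => (Z ω, Q ω)) ⁻¹' E =
      B ∩ {ω | α * ‖v ω‖ ≤ ‖Matrix.toEuclideanLin (Q ω).transpose (v ω)‖} := by
    ext ω
    simp [E, Z, Set.indicator_apply]
  have hZB : Z ⁻¹' {z | z.2 = 1} = B := by
    ext ω
    simp [Z, Set.indicator_apply]
  have hS : MeasurableSet {z : Vec n × ℝ | z.2 = 1} :=
    measurable_snd (measurableSet_singleton 1)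
  have key : ENNReal.ofReal (1 - β) * μ B ≤ μ ((fun ω => (Z ω, Q ω)) ⁻¹' E) := by
    rw [← Measure.map_apply (hZ.prodMk hQ) hE, hmap, Measure.prod_apply hE]
    calc ENNReal.ofReal (1 - β) * μ B
        = ∫⁻ z, {z : Vec n × ℝ | z.2 = 1}.indicator (fun _ => ENNReal.ofReal (1 - β)) z
            ∂(μ.map Z) := by
          rw [lintegral_indicator hS, setLIntegral_const, Measure.map_apply hZ hS, hZB]
      _ ≤ _ := by
          refine lintegral_mono fun z => ?_
          by_cases hz : z.2 = 1
          · rw [Set.indicator_of_mem (by exact hz),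
              Measure.map_apply hQ (measurable_prodMk_left hE)]
            refine (ENNReal.ofReal_le_ofReal (h z.1)).trans ?_
            rw [ofReal_measureReal]
            exact measure_mono fun ω hω => ⟨hz, hω⟩
          · rw [Set.indicator_of_notMem (by exact hz)]
            exact zero_le
  rw [← hpre]
  have := ENNReal.toReal_mono (measure_ne_top _ _) key
  rw [ENNReal.toReal_mul] at this
  refine le_trans ?_ this
  exact mul_le_mul_of_nonneg_right (by
    rw [ENNReal.toReal_ofReal']; exact le_max_left _ _) ENNReal.toReal_nonneg

namespace Inputs

variable {P : Params} {Ω : Type*} {n p m : ℕ} {R : Inputs Ω n p m} {x₀ : Vec n}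
variable {f : Vec n → ℝ} {fmin ν βf : ℝ}
/-- How far the logarithm of the stepsize lies below that of a threshold `d`. -/
noncomputable def deficit (R : Inputs Ω n p m) (P : Params) (x₀ : Vec n) (d : ℝ) (k : ℕ)
    (ω : Ω) : ℝ :=
  max 0 (Real.log (d / R.δ P x₀ k ω))

lemma deficit_succ_le (hP : P.Admissible) {d : ℝ} (hd : 0 < d) (k : ℕ) (ω : Ω) :
    R.deficit P x₀ d (k + 1) ω ≤ R.deficit P x₀ d k ω - Real.log P.τ := by
  have hδ := δ_pos (R := R) (x₀ := x₀) hP k ω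
  have hδ' := δ_pos (R := R) (x₀ := x₀) hP (k + 1) ω
  have hτ := hP.τ_pos
  have hlog : Real.log P.τ < 0 := Real.log_neg hτ hP.τ_lt_one
  have h0 : 0 ≤ R.deficit P x₀ d k ω := le_max_left _ _
  refine max_le (by linarith) ?_
  have h1 : Real.log (d / R.δ P x₀ (k + 1) ω) ≤ Real.log (d / R.δ P x₀ k ω / P.τ) := by
    refine Real.log_le_log (by positivity) ?_
    rw [div_div]
    have := τ_mul_δ_le_δ_succ (R := R) (x₀ := x₀) hP k ω
    gcongr
    linarith
  rw [Real.log_div (by positivity) hτ.ne'] at h1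
  exact h1.trans (sub_le_sub_right (le_max_right _ _) _)

/-- The threshold `τ d`, rather than `d`, ensures that the enlarged stepsize stays below `d`.
Neither the cap `δmax` nor the truncation at zero interferes, and a success gains the full `-log τ`.
-/
lemma deficit_succ_le_of_successful (hP : P.Admissible) {d : ℝ} (hdm : d ≤ P.δmax) {k : ℕ}
    {ω : Ω} (hs : ω ∈ R.successful P x₀ k) (hδd : R.δ P x₀ k ω < P.τ * d) :
    R.deficit P x₀ d (k + 1) ω ≤ R.deficit P x₀ d k ω + Real.log P.τ := by
  have hδ := δ_pos (R := R) (x₀ := x₀) hP k ω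
  have hτ := hP.τ_pos
  have hd : 0 < d := pos_of_mul_pos_right (hδ.trans hδd) hτ.le
  have h1 : P.τ⁻¹ * R.δ P x₀ k ω < d := by
    rw [inv_mul_lt_iff₀ hτ]; exact hδd
  have h2 : d / R.δ P x₀ (k + 1) ω = d / R.δ P x₀ k ω * P.τ := by
    rw [δ_succ_of_successful hs, min_eq_left (h1.le.trans hdm)]
    field_simp
  have h3 : Real.log (d / R.δ P x₀ (k + 1) ω) = Real.log (d / R.δ P x₀ k ω) + Real.log P.τ := by
    rw [h2, Real.log_mul (by positivity) hτ.ne']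
  have h4 : 0 ≤ Real.log (d / R.δ P x₀ (k + 1) ω) := by
    refine Real.log_nonneg ?_
    rw [h2, div_mul_eq_mul_div, le_div_iff₀ hδ]
    linarith
  unfold deficit
  rw [max_eq_right h4, h3]
  exact add_le_add_left (le_max_right _ _) _

variable [mΩ : MeasurableSpace Ω] {μ : Measure Ω} {αQ βQ : ℝ}

/-- The event that none of the first `k + 1` gradients is at most `ε`. -/
def notYet (R : Inputs Ω n p m) (P : Params) (x₀ : Vec n) (f : Vec n → ℝ) (ε : ℝ) (k : ℕ) :
    Set Ω :=
  {ω | ∀ i ≤ k, ε < ‖∇ f (R.x P x₀ i ω)‖}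

lemma IsRun.measurableSet_notYet (hR : R.IsRun μ P x₀ αQ βQ) (hp : 1 ≤ p)
    (hg : Continuous (∇ f)) (ε : ℝ) (k : ℕ) :
    MeasurableSet[R.past k] (R.notYet P x₀ f ε k) := by
  have : R.notYet P x₀ f ε k = ⋂ i, ⋂ (_ : i ≤ k), {ω | ε < ‖∇ f (R.x P x₀ i ω)‖} := by
    ext; simp [notYet]
  rw [this]
  refine MeasurableSet.iInter fun i => MeasurableSet.iInter fun hi => ?_
  exact measurableSet_lt_norm (hg.measurable.comp
    ((hR.measurable_x hp i).mono (past_mono hi) le_rfl)) ε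

variable [IsProbabilityMeasure μ]

/-- The conditional probability of success with a small stepsize, in integrated form. -/
lemma IsRun.le_measureReal_inter_successful (hR : R.IsRun μ P x₀ αQ βQ) (hP : P.Admissible)
    (hp : 1 ≤ p) (hm : 0 < m) {L : ℝ≥0} (hf : Differentiable ℝ f) (hL : LipschitzWith L (∇ f))
    (hest : R.EstimatesOK μ P x₀ f βf) (hα : 0 < αQ) (hβ0 : 0 < βf) {κ ε : ℝ} (hκ0 : 0 < κ)
    {k : ℕ} (hκ : ∀ᵐ ω ∂μ, κ ≤ cosineMeasure (Set.range (R.D k ω)))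
    {B : Set Ω} (hB : MeasurableSet[R.past k] B)
    (hBg : ∀ ω ∈ B, ε < ‖∇ f (R.x P x₀ k ω)‖)
    (hBδ : ∀ ω ∈ B,
      R.δ P x₀ k ω * (√((n : ℝ) / p) * (L + (P.γ + 2) * P.εf)) ≤ κ * αQ * ε) :
    βf * (1 - βQ) * μ.real B ≤ μ.real (B ∩ R.successful P x₀ k) := by
  have : Nonempty (Fin m) := ⟨⟨0, hm⟩⟩
  have hg : Measurable[R.past k] fun ω => ∇ f (R.x P x₀ k ω) :=
    hL.continuous.measurable.comp (hR.measurable_x hp k)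
  let I : Set Ω := {ω | αQ * ‖∇ f (R.x P x₀ k ω)‖ ≤
    ‖Matrix.toEuclideanLin (R.Q k ω).transpose (∇ f (R.x P x₀ k ω))‖}
  have hQind : Indep (MeasurableSpace.comap (R.Q k) inferInstance) (R.past k) μ := by
    refine indep_of_indep_of_le_left (hR.indep_past k) ?_
    have : R.Q k = Prod.fst ∘ fun ω => (R.Q k ω, R.D k ω) := rfl
    rw [this, ← MeasurableSpace.comap_comp]
    exact MeasurableSpace.comap_mono measurable_fst.comap_le
  have h1 : (1 - βQ) * μ.real B ≤ μ.real (B ∩ I) :=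
    (hR.wellAligned k).le_measureReal_inter (hR.measurable_Q k) (hR.past_le k) hQind hg hB
  have hg' : Measurable[R.pastQD k] fun ω => ∇ f (R.x P x₀ k ω) :=
    hg.mono (past_le_pastQD k) le_rfl
  -- Alignment is decided once `Q` is drawn, so accuracy may be conditioned on it; the two
  -- probabilities multiply without independence of the two events.
  have hI : MeasurableSet[R.pastQD k] I :=
    measurableSet_mul_norm_le (R.measurable_Q_pastQD k) hg' αQ
  have hBI : MeasurableSet[R.pastQD k] (B ∩ I) :=
    MeasurableSet.inter (past_le_pastQD k _ hB) hI
  have hJ := hR.measurableSet_accurate hp hf.continuous k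
  have h2 := integral_mul_le_of_le_condExp (hR.pastQD_le k)
    (Measurable.indicator (@measurable_const ℝ Ω _ (R.pastQD k) 1) hBI)
    (fun ω => Set.indicator_nonneg (fun _ _ => zero_le_one) ω) (c := 1)
    (fun ω => Set.indicator_le_self' (fun _ _ => zero_le_one) ω)
    ((integrable_const (1 : ℝ)).indicator hJ) (integrable_const βf) (hest.accurate k)
  have hBI' : MeasurableSet (B ∩ I) := hR.pastQD_le k _ hBI
  have h3 : (fun ω => (B ∩ I).indicator (fun _ => (1 : ℝ)) ω *
      (R.accurate P x₀ f k).indicator (fun _ => 1) ω) =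
      ((B ∩ I) ∩ R.accurate P x₀ f k).indicator fun _ => 1 := by
    funext ω
    exact (congrFun Set.inter_indicator_one ω).symm
  rw [h3, integral_mul_const, integral_indicator_const _ hBI',
    integral_indicator_const _ (hBI'.inter hJ), smul_eq_mul, smul_eq_mul, mul_one, mul_one] at h2
  have h4 : μ.real ((B ∩ I) ∩ R.accurate P x₀ f k) ≤ μ.real (B ∩ R.successful P x₀ k) := by
    refine ENNReal.toReal_mono (measure_ne_top _ _) (measure_mono_ae ?_)
    filter_upwards [hR.norm_D k, hκ] with ω hD hκω hω
    exact ⟨hω.1.1, mem_successful_of_accurate hP hp hf hL hα hκ0 hD hκω hω.1.2 hω.2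
      (hBg ω hω.1.1) (hBδ ω hω.1.1)⟩
  have h5 := mul_le_mul_of_nonneg_left h1 hβ0.le
  linarith

lemma IsRun.integrable_deficit (hR : R.IsRun μ P x₀ αQ βQ) (hP : P.Admissible) (hp : 1 ≤ p)
    {d : ℝ} (hd : 0 < d) (k : ℕ) : Integrable (R.deficit P x₀ d k) μ := by
  have hlow : 0 < P.τ ^ k * P.δ₀ := mul_pos (pow_pos hP.τ_pos k) hP.δ₀_pos
  refine Integrable.of_bound (measurable_const.max (Real.measurable_log.comp
    (measurable_const.div
      ((hR.measurable_δ hp k).mono (hR.past_le k) le_rfl)))).aestronglyMeasurable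
    (max 0 (Real.log (d / (P.τ ^ k * P.δ₀)))) (ae_of_all _ fun ω => ?_)
  rw [Real.norm_of_nonneg (show 0 ≤ R.deficit P x₀ d k ω from le_max_left _ _)]
  have := δ_pos (R := R) (x₀ := x₀) hP k ω
  exact max_le_max le_rfl (Real.log_le_log (by positivity)
    (div_le_div_of_nonneg_left hd.le hlow (pow_mul_le_δ hP k ω)))

/-- Iterations with a small stepsize are outweighed by those with a large one. -/
lemma IsRun.sum_measureReal_small_le (hR : R.IsRun μ P x₀ αQ βQ) (hP : P.Admissible)
    (hp : 1 ≤ p) {d b : ℝ} (hd : 0 < d) (hd0 : d ≤ P.δ₀) {A : ℕ → Set Ω}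
    (hA : ∀ k, MeasurableSet[R.past k] (A k)) (hanti : Antitone A)
    (hsucc : ∀ k, b * μ.real (A k ∩ {ω | R.δ P x₀ k ω < P.τ * d}) ≤
      μ.real (A k ∩ {ω | R.δ P x₀ k ω < P.τ * d} ∩ R.successful P x₀ k)) (N : ℕ) :
    (2 * b - 1) * ∑ k ∈ Finset.range N, μ.real (A k ∩ {ω | R.δ P x₀ k ω < P.τ * d}) ≤
      ∑ k ∈ Finset.range N, μ.real (A k ∩ {ω | P.τ * d ≤ R.δ P x₀ k ω}) := by
  classical
  set ℓ := -Real.log P.τ with hℓ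
  have hℓ0 : 0 < ℓ := neg_pos.2 (Real.log_neg hP.τ_pos hP.τ_lt_one)
  have hA' : ∀ k, MeasurableSet (A k) := fun k => hR.past_le k _ (hA k)
  have hδ : ∀ k, Measurable (R.δ P x₀ k) := fun k =>
    (hR.measurable_δ hp k).mono (hR.past_le k) le_rfl
  let V : ℕ → Ω → ℝ := R.deficit P x₀ d
  have hV0 : ∀ k ω, 0 ≤ V k ω := fun k ω => le_max_left _ _
  have hVi : ∀ k, Integrable (V k) μ := hR.integrable_deficit hP hp hd
  have hstep : ∀ k, ∫ ω in A (k + 1), V (k + 1) ω ∂μ ≤ ∫ ω in A k, V k ω ∂μ +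
      ℓ * (μ.real (A k ∩ {ω | P.τ * d ≤ R.δ P x₀ k ω}) -
        (2 * b - 1) * μ.real (A k ∩ {ω | R.δ P x₀ k ω < P.τ * d})) := by
    intro k
    have hBm : MeasurableSet (A k ∩ {ω | R.δ P x₀ k ω < P.τ * d}) :=
      (hA' k).inter (measurableSet_lt (hδ k) measurable_const)
    have hCm : MeasurableSet (A k ∩ {ω | P.τ * d ≤ R.δ P x₀ k ω}) :=
      (hA' k).inter (measurableSet_le measurable_const (hδ k))
    have hSm := hBm.inter (hR.measurableSet_successful hp k)
    have hone : Integrable (fun _ : Ω => (1 : ℝ)) μ := integrable_const 1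
    have i2 := (hone.indicator hSm).const_mul 2
    have i3 : Integrable (fun ω =>
        (A k ∩ {ω | R.δ P x₀ k ω < P.τ * d}).indicator (fun _ => (1 : ℝ)) ω -
        2 * (A k ∩ {ω | R.δ P x₀ k ω < P.τ * d} ∩ R.successful P x₀ k).indicator
          (fun _ => (1 : ℝ)) ω) μ := (hone.indicator hBm).sub i2
    have i4 : Integrable (fun ω => ℓ *
        ((A k ∩ {ω | P.τ * d ≤ R.δ P x₀ k ω}).indicator (fun _ => (1 : ℝ)) ω +
          ((A k ∩ {ω | R.δ P x₀ k ω < P.τ * d}).indicator (fun _ => (1 : ℝ)) ω -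
          2 * (A k ∩ {ω | R.δ P x₀ k ω < P.τ * d} ∩ R.successful P x₀ k).indicator
            (fun _ => (1 : ℝ)) ω))) μ := ((hone.indicator hCm).add i3).const_mul ℓ
    -- Discarding the paths that stop between `k` and `k + 1` only lowers the integral, since the
    -- deficit is nonnegative.
    have h1 : ∫ ω in A (k + 1), V (k + 1) ω ∂μ ≤ ∫ ω in A k, V (k + 1) ω ∂μ :=
      setIntegral_mono_set (hVi (k + 1)).integrableOn (ae_of_all _ (hV0 (k + 1)))
        (Filter.Eventually.of_forall (hanti k.le_succ))
    -- In units of `ℓ` the deficit changes by at most `+1` on large iterations, `+1` on small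
    -- failures and `-1` on small successes; the last two combine into one indicator minus twice
    -- another.
    have h2 : ∫ ω in A k, V (k + 1) ω ∂μ ≤
        ∫ ω, ((A k).indicator (V k) ω +
          ℓ * ((A k ∩ {ω | P.τ * d ≤ R.δ P x₀ k ω}).indicator (fun _ => (1 : ℝ)) ω +
            ((A k ∩ {ω | R.δ P x₀ k ω < P.τ * d}).indicator (fun _ => (1 : ℝ)) ω -
            2 * (A k ∩ {ω | R.δ P x₀ k ω < P.τ * d} ∩ R.successful P x₀ k).indicator
              (fun _ => (1 : ℝ)) ω))) ∂μ := by
      rw [← integral_indicator (hA' k)]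
      refine integral_mono ((hVi (k + 1)).indicator (hA' k))
        (((hVi k).indicator (hA' k)).add i4) fun ω => ?_
      by_cases hω : ω ∈ A k
      · have h3 : V (k + 1) ω ≤ V k ω - Real.log P.τ := deficit_succ_le hP hd k ω
        by_cases hs : R.δ P x₀ k ω < P.τ * d
        · by_cases hS : ω ∈ R.successful P x₀ k
          · have h4 : V (k + 1) ω ≤ V k ω + Real.log P.τ :=
              deficit_succ_le_of_successful hP (hd0.trans hP.δ₀_le_δmax) hS hs
            simp only [Set.indicator_apply, Set.mem_inter_iff, hω, Set.mem_ofPred_eq, hs, hS,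
              hs.not_ge, and_self, if_true, if_false, and_false]
            linarith
          · simp only [Set.indicator_apply, Set.mem_inter_iff, hω, Set.mem_ofPred_eq, hs, hS,
              hs.not_ge, and_self, if_true, if_false, and_false]
            linarith
        · simp only [Set.indicator_apply, Set.mem_inter_iff, hω, Set.mem_ofPred_eq, hs,
            not_lt.1 hs, and_self, if_true, if_false, and_false, false_and]
          linarith
      · simp [hω]
    rw [integral_add ((hVi k).indicator (hA' k)) i4, integral_const_mul,
      integral_add (hone.indicator hCm) i3, integral_sub (hone.indicator hBm) i2,
      integral_const_mul, integral_indicator (hA' k), integral_indicator_const _ hCm,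
      integral_indicator_const _ hBm, integral_indicator_const _ hSm] at h2
    simp only [smul_eq_mul, mul_one] at h2
    have h3 := mul_le_mul_of_nonneg_left (hsucc k) hℓ0.le
    linarith
  have hsum : ∫ ω in A N, V N ω ∂μ ≤
      ℓ * (∑ k ∈ Finset.range N, μ.real (A k ∩ {ω | P.τ * d ≤ R.δ P x₀ k ω}) -
        (2 * b - 1) *
          ∑ k ∈ Finset.range N, μ.real (A k ∩ {ω | R.δ P x₀ k ω < P.τ * d})) := by
    induction N with
    | zero =>
      -- The condition `d ≤ δ₀` starts the deficit at zero, so no initial term enters.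
      have : V 0 = 0 := by
        funext ω
        refine max_eq_left (Real.log_nonpos ?_ ?_)
        · exact div_nonneg hd.le hP.δ₀_pos.le
        · exact (div_le_one hP.δ₀_pos).2 hd0
      simp [this]
    | succ N ih =>
      rw [Finset.sum_range_succ, Finset.sum_range_succ]
      have := hstep N
      linarith
  have h0 : 0 ≤ ∫ ω in A N, V N ω ∂μ := integral_nonneg (hV0 N)
  exact sub_nonneg.1 (nonneg_of_mul_nonneg_right (h0.trans hsum) hℓ0)

end Inputs

end StoDARS

/-! ### From counting iterations to the expected hitting time -/

namespace StoDARS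

/-- The first index satisfying `q` is at most the number of indices before it. -/
lemma iInf_natCast_le_tsum {q : ℕ → Prop} :
    ((⨅ k : ℕ, ⨅ _ : q k, (k : ℕ∞) : ℕ∞) : ℝ≥0∞) ≤
      ∑' k, {k | ∀ i ≤ k, ¬ q i}.indicator (fun _ => (1 : ℝ≥0∞)) k := by
  classical
  by_cases h : ∃ k, q k
  · have h1 : (⨅ k : ℕ, ⨅ _ : q k, (k : ℕ∞)) ≤ (Nat.find h : ℕ∞) :=
      iInf₂_le (Nat.find h) (Nat.find_spec h)
    refine (ENat.toENNReal_le.2 h1).trans ?_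
    refine le_trans (le_of_eq ?_) (ENNReal.sum_le_tsum (Finset.range (Nat.find h)))
    rw [Finset.sum_congr rfl (g := fun _ => 1) fun k hk => ?_]
    · simp
    · refine Set.indicator_of_mem ?_ _
      exact fun i hi => Nat.find_min h (hi.trans_lt (Finset.mem_range.1 hk))
  · have h1 : {k | ∀ i ≤ k, ¬ q i} = Set.univ :=
      Set.eq_univ_of_forall fun k i _ hi => h ⟨i, hi⟩
    rw [h1, Set.indicator_univ, ENNReal.tsum_const_eq_top_of_ne_zero one_ne_zero]
    exact le_top

namespace Inputs

variable {P : Params} {Ω : Type*} {n p m : ℕ} {R : Inputs Ω n p m} {x₀ : Vec n}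
variable {f : Vec n → ℝ} {fmin ν βf : ℝ}
variable [mΩ : MeasurableSpace Ω] {μ : Measure Ω} {αQ βQ : ℝ}

/-- The hitting time is bounded by a sum of indicators, one per index not preceded by or equal to a
hit. This also covers paths that never hit, so finiteness need not be known beforehand. -/
lemma expectedHitTime_le_of_sum_le {ε C : ℝ}
    (hmeas : ∀ k, MeasurableSet (R.notYet P x₀ f ε k)) [IsFiniteMeasure μ]
    (h : ∀ N, ∑ k ∈ Finset.range N, μ.real (R.notYet P x₀ f ε k) ≤ C) :
    R.expectedHitTime μ P x₀ f ε ≤ ENNReal.ofReal C := by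
  calc R.expectedHitTime μ P x₀ f ε
      ≤ ∫⁻ ω, ∑' k, (R.notYet P x₀ f ε k).indicator (fun _ => (1 : ℝ≥0∞)) ω ∂μ := by
        refine lintegral_mono fun ω => ?_
        refine iInf_natCast_le_tsum.trans (le_of_eq (tsum_congr fun k => ?_))
        classical
        simp [Set.indicator_apply, notYet]
    _ = ∑' k, μ (R.notYet P x₀ f ε k) := by
        rw [lintegral_tsum fun k => (measurable_const.indicator (hmeas k)).aemeasurable]
        exact tsum_congr fun k => by rw [lintegral_indicator_const (hmeas k), one_mul]
    _ ≤ ENNReal.ofReal C := by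
        refine ENNReal.tsum_le_of_sum_range_le fun N => ?_
        refine le_trans (le_of_eq ?_) (ENNReal.ofReal_le_ofReal (h N))
        rw [ENNReal.ofReal_sum_of_nonneg fun _ _ => measureReal_nonneg]
        exact Finset.sum_congr rfl fun k _ => (ofReal_measureReal).symm

variable [IsProbabilityMeasure μ]

/-- Complexity bound in terms of a threshold `d` below which accurate iterations with an aligned
subspace are successful. -/
lemma IsRun.expectedHitTime_le (hR : R.IsRun μ P x₀ αQ βQ) (hP : P.Admissible)
    (hp : 1 ≤ p) (hm : 0 < m) {L : ℝ≥0} (hf : Differentiable ℝ f) (hL : LipschitzWith L (∇ f))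
    (hmin : ∀ y, fmin ≤ f y) (hest : R.EstimatesOK μ P x₀ f βf) (hα : 0 < αQ) (hβ0 : 0 < βf)
    (hβ1 : βf < 1) (hβ2 : 4 * ν / ((1 - ν) * (1 - P.τ ^ 2)) ≤ βf / (1 - βf))
    (hν : 0 < ν) (hν1 : ν < 1)
    (hν2 : 2 * ((P.τ ^ 2)⁻¹ - 1) / (P.γ - 2) ≤ ν / (1 - ν))
    (hb : 1 / 2 < βf * (1 - βQ)) {κ : ℝ} (hκ0 : 0 < κ)
    (hκ : ∀ k, ∀ᵐ ω ∂μ, κ ≤ cosineMeasure (Set.range (R.D k ω)))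
    {ε d : ℝ} (hd : 0 < d) (hd0 : d ≤ P.δ₀)
    (hdε : d * (√((n : ℝ) / p) * (L + (P.γ + 2) * P.εf)) ≤ κ * αQ * ε) :
    R.expectedHitTime μ P x₀ f ε ≤ ENNReal.ofReal
      (2 * (βf * (1 - βQ)) / (2 * (βf * (1 - βQ)) - 1) *
        (phiZero P x₀ f fmin ν / (rho P ν βf * (P.τ * d) ^ 2))) := by
  set b := βf * (1 - βQ) with hbdef
  have hτ := hP.τ_pos
  have hρ : 0 < rho P ν βf := by
    have h1 : 0 < 1 - P.τ ^ 2 :=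
      sub_pos.2 (pow_lt_one₀ hτ.le hP.τ_lt_one two_ne_zero)
    have h2 := sub_pos.2 hν1
    unfold rho
    positivity
  have hK : 0 ≤ √((n : ℝ) / p) * (L + (P.γ + 2) * P.εf) := by
    have h1 := hP.εf_pos
    have h2 : 0 < P.γ + 2 := by linarith [hP.two_lt_γ]
    positivity
  have hδm : ∀ k, Measurable[R.past k] (R.δ P x₀ k) := hR.measurable_δ hp
  have hA := hR.measurableSet_notYet (f := f) hp hL.continuous ε
  refine expectedHitTime_le_of_sum_le (fun k => hR.past_le k _ (hA k)) fun N => ?_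
  have h1 := hR.sum_measureReal_small_le hP hp hd hd0 hA
    (fun i j hij ω hω l hl => hω l (hl.trans hij)) (b := b) (fun k => by
      refine hR.le_measureReal_inter_successful hP hp hm hf hL hest hα hβ0 hκ0 (ε := ε)
        (hκ k) ((hA k).inter (hδm k measurableSet_Iio)) (fun ω hω => hω.1 k le_rfl)
        fun ω hω => ?_
      refine le_trans (mul_le_mul_of_nonneg_right ?_ hK) hdε
      exact (le_of_lt hω.2).trans (mul_le_of_le_one_left hd.le hP.τ_lt_one.le)) N
  have h2 : ∑ k ∈ Finset.range N, μ.real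
      (R.notYet P x₀ f ε k ∩ {ω | P.τ * d ≤ R.δ P x₀ k ω}) ≤
      phiZero P x₀ f fmin ν / (rho P ν βf * (P.τ * d) ^ 2) := by
    rw [le_div_iff₀ (by positivity)]
    refine le_trans ?_ (hR.rho_mul_sum_integral_le hP hp hν hν1 hν2 hβ1 hβ2 hf.continuous
      hmin hest N)
    rw [mul_comm, mul_assoc, Finset.mul_sum]
    refine mul_le_mul_of_nonneg_left (Finset.sum_le_sum fun k _ => ?_) hρ.le
    -- Markov's inequality for `δ_k ^ 2` at level `(τ d) ^ 2`.
    refine le_trans ?_ (mul_meas_ge_le_integral_of_nonneg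
      (ae_of_all _ fun ω => sq_nonneg (R.δ P x₀ k ω)) (hR.integrable_δ_sq hP hp k)
      ((P.τ * d) ^ 2))
    refine mul_le_mul_of_nonneg_left (measureReal_mono fun ω hω => ?_) (sq_nonneg _)
    exact pow_le_pow_left₀ (mul_pos hτ hd).le (show P.τ * d ≤ R.δ P x₀ k ω from hω.2) 2
  have h3 : ∑ k ∈ Finset.range N, μ.real (R.notYet P x₀ f ε k) =
      ∑ k ∈ Finset.range N, μ.real
        (R.notYet P x₀ f ε k ∩ {ω | P.τ * d ≤ R.δ P x₀ k ω}) +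
      ∑ k ∈ Finset.range N, μ.real
        (R.notYet P x₀ f ε k ∩ {ω | R.δ P x₀ k ω < P.τ * d}) := by
    rw [← Finset.sum_add_distrib]
    refine Finset.sum_congr rfl fun k _ => ?_
    rw [← measureReal_inter_add_sdiff (s := R.notYet P x₀ f ε k)
      (t := {ω | P.τ * d ≤ R.δ P x₀ k ω})
      (hR.past_le k _ (hδm k measurableSet_Ici))]
    congr 2
    ext ω
    simp
  have h4 : 0 < 2 * b - 1 := by linarith
  rw [h3, div_mul_eq_mul_div, le_div_iff₀ h4]
  -- `(2 b - 1) (large + small) ≤ (2 b - 1) large + large = 2 b large`.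
  nlinarith

end Inputs

end StoDARS

/-! ### Choice of the constant -/

theorem mainTheorem3
    (n p : ℕ) (hp : 1 ≤ p) (hpn : p ≤ n)
    (P : StoDARS.Params) (hP : P.Admissible)
    (αQ βQ κmin : ℝ) (hαQ : 0 < αQ ∧ αQ < 1 / 2) (hβQ : 0 < βQ ∧ βQ < 1 / 2)
    (hκmin : 0 < κmin) (L : ℝ≥0) :
    -- the constant depends neither on the accuracy `ε` nor on `f` nor on the random process
    ∃ ξ : ℝ, StoDARS.xiHat P n p αQ κmin L ≤ ξ ∧
      ∀ (m : ℕ), p + 1 ≤ m → m ≤ 2 * n →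
      ∀ (ν βf : ℝ), 0 < ν → ν < 1 →
        2 * ((P.τ ^ 2)⁻¹ - 1) / (P.γ - 2) ≤ ν / (1 - ν) →
        0 < βf → βf < 1 →
        4 * ν / ((1 - ν) * (1 - P.τ ^ 2)) ≤ βf / (1 - βf) →
        1 / 2 < βf * (1 - βQ) →
      ∀ (f : StoDARS.Vec n → ℝ) (fmin : ℝ), Differentiable ℝ f → LipschitzWith L (∇ f) →
        (∀ y, fmin ≤ f y) →
      ∀ (Ω : Type*) [MeasurableSpace Ω] (μ : Measure Ω) [IsProbabilityMeasure μ]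
        (x₀ : StoDARS.Vec n) (R : StoDARS.Inputs Ω n p m),
        R.IsRun μ P x₀ αQ βQ →
        (∀ k, ∀ᵐ ω ∂μ, κmin ≤ StoDARS.cosineMeasure (Set.range (R.D k ω))) →
        R.EstimatesOK μ P x₀ f βf →
        (∀ ε : ℝ, 0 < ε → ε < 1 →
          R.expectedHitTime μ P x₀ f ε ≤ ENNReal.ofReal
            (βf * (1 - βQ) / (2 * (βf * (1 - βQ)) - 1) *
              (StoDARS.phiZero P x₀ f fmin ν * ξ ^ 2 / (StoDARS.rho P ν βf * ε ^ 2)) + 1)) ∧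
        ∃ C : ℝ, ∀ ε : ℝ, 0 < ε → ε < 1 →
          R.expectedHitTime μ P x₀ f ε ≤ ENNReal.ofReal (C / ε ^ 2) := by

  set K : ℝ := √((n : ℝ) / p) * (L + (P.γ + 2) * P.εf) with hK
  -- The threshold will be `d = ε / ξ'`: the first entry makes small stepsizes successful, the
  -- second gives `d ≤ δ₀` because `ε < 1`.
  set ξ' : ℝ := max (K / (κmin * αQ)) (1 / P.δ₀) with hξ'
  have hδ₀ := hP.δ₀_pos
  have hτ := hP.τ_pos
  have hκα : 0 < κmin * αQ := mul_pos hκmin hαQ.1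
  have hξ'0 : 0 < ξ' := lt_of_lt_of_le (by positivity) (le_max_right _ _)
  -- Division by `τ` accounts for counting at level `τ d`, and the factor 2, once squared, more than
  -- absorbs the 2 in `2 b / (2 b - 1)`.
  refine ⟨max (StoDARS.xiHat P n p αQ κmin L) (2 * ξ' / P.τ), le_max_left _ _, ?_⟩
  set ξ := max (StoDARS.xiHat P n p αQ κmin L) (2 * ξ' / P.τ)
  intro m hm _ ν βf hν hν1 hν2 hβ0 hβ1 hβ2 hb f fmin hf hL hmin Ω _ μ _ x₀ R hR hκ hest
  have hφ : 0 ≤ StoDARS.phiZero P x₀ f fmin ν := by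
    have h1 := hP.εf_pos
    have h2 := sub_nonneg.2 (hmin x₀)
    have h3 := sub_pos.2 hν1
    unfold StoDARS.phiZero
    positivity
  have hρ : 0 < StoDARS.rho P ν βf := by
    have h1 : 0 < 1 - P.τ ^ 2 :=
      sub_pos.2 (pow_lt_one₀ hτ.le hP.τ_lt_one two_ne_zero)
    have h2 := sub_pos.2 hν1
    unfold StoDARS.rho
    positivity
  have hb0 : 0 < 2 * (βf * (1 - βQ)) - 1 := by linarith
  have hb1 : 0 < βf * (1 - βQ) := by linarith
  have key : ∀ ε : ℝ, 0 < ε → ε < 1 →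
      R.expectedHitTime μ P x₀ f ε ≤ ENNReal.ofReal
        (βf * (1 - βQ) / (2 * (βf * (1 - βQ)) - 1) *
          (StoDARS.phiZero P x₀ f fmin ν * ξ ^ 2 / (StoDARS.rho P ν βf * ε ^ 2)) + 1) := by
    intro ε hε hε1
    have hdδ : ε / ξ' ≤ P.δ₀ := by
      rw [div_le_iff₀ hξ'0]
      have : 1 ≤ ξ' * P.δ₀ := (div_le_iff₀ hδ₀).1 (le_max_right _ _)
      linarith
    have hdK : ε / ξ' * K ≤ κmin * αQ * ε := by
      rw [div_mul_eq_mul_div, div_le_iff₀ hξ'0]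
      have : K ≤ ξ' * (κmin * αQ) := (div_le_iff₀ hκα).1 (le_max_left _ _)
      nlinarith
    refine (hR.expectedHitTime_le hP hp (by omega) hf hL hmin hest hαQ.1 hβ0 hβ1 hβ2 hν hν1
      hν2 hb hκmin hκ (by positivity) hdδ hdK).trans (ENNReal.ofReal_le_ofReal ?_)
    have hξ : 2 * (ξ' / P.τ) ^ 2 ≤ ξ ^ 2 := by
      have h1 : 2 * (ξ' / P.τ) ≤ ξ := by
        rw [← mul_div_assoc]; exact le_max_right _ _
      have h2 : 0 < ξ' / P.τ := by positivity
      nlinarith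
    calc 2 * (βf * (1 - βQ)) / (2 * (βf * (1 - βQ)) - 1) *
          (StoDARS.phiZero P x₀ f fmin ν / (StoDARS.rho P ν βf * (P.τ * (ε / ξ')) ^ 2))
        = βf * (1 - βQ) / (2 * (βf * (1 - βQ)) - 1) *
          (StoDARS.phiZero P x₀ f fmin ν * (2 * (ξ' / P.τ) ^ 2) /
            (StoDARS.rho P ν βf * ε ^ 2)) := by
          field_simp
      _ ≤ βf * (1 - βQ) / (2 * (βf * (1 - βQ)) - 1) *
          (StoDARS.phiZero P x₀ f fmin ν * ξ ^ 2 / (StoDARS.rho P ν βf * ε ^ 2)) := by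
          gcongr
      _ ≤ _ := le_add_of_nonneg_right zero_le_one
  -- The additive 1 is at most `1 / ε ^ 2`, since `ε < 1`, and joins the constant.
  refine ⟨key, βf * (1 - βQ) / (2 * (βf * (1 - βQ)) - 1) *
    (StoDARS.phiZero P x₀ f fmin ν * ξ ^ 2 / StoDARS.rho P ν βf) + 1, fun ε hε hε1 => ?_⟩
  refine (key ε hε hε1).trans (ENNReal.ofReal_le_ofReal ?_)
  rw [add_div]
  refine add_le_add (le_of_eq (by field_simp)) ?_
  rw [le_div_iff₀ (by positivity), one_mul]
  exact pow_le_one₀ hε.le hε1.le
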